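/- Let $q$ be a fixed prime power. For each $n$, let $v_1,v_2,\ldots$ be independent uniformly random vectors in $\mathbb{F}_q^n$, let $A_m=[v_1,\ldots,v_m]$, and let $M[A_m]$ be the matroid on the column indices $\{1,\dots,m\}$ represented by $A_m$ (a set of indices is independent if and only if the corresponding family of columns is linearly independent). A $k$-circuit is a minimal dependent set with exactly $k$ elements. Let $\tau_{k\text{-circ}}$ be the smallest $m$ such that $M[A_m]$ has a $k$-circuit ($\infty$ if there is none). For $0<a\le 1$ put $$g_a(y)=y\log y+a\log(q-1)-a\log a-(y-a)\log(y-a)-\log q,\qquad y\ge a,$$ where $0\log 0=0$. For random variables $X_n$ and nonnegative reals $x_n$, write $X_n=\Theta_p(x_n)$ if $$\lim_{\varepsilon\to0^+}\limsup_{n\to\infty}\bigl(\mathbb P(X_n<\varepsilon x_n)+\mathbb P(X_n>\varepsilon^{-1}x_n)\bigr)=0,$$ and say that a.a.s. $X_n\sim x_n$ if for every $\varepsilon>0$, $\mathbb P\bigl((1-\varepsilon)x_n\le X_n\le(1+\varepsilon)x_n\bigr)\to1$ as $n\to\infty$. Then the following hold as $n\to\infty$. (a) For every fixed integer $k\ge1$,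 $\tau_{k\text{-circ}}=\Theta_p(q^{n/k})$. (b) If $k=k(n)\to\infty$ and $k=o(n)$, then a.a.s. $\tau_{k\text{-circ}}\sim \frac{1}{e(q-1)}\,k\,q^{n/k}$. (c) For every fixed $0<a\le1$, the function $g_a$ has a unique root $b=b(a)$ in $[a,\infty)$; and if $k=k(n)\sim an$ with $k\le n+1$ for all sufficiently large $n$, then a.a.s. $\tau_{k\text{-circ}}\sim bn$. -/

import Mathlib

open MeasureTheory ProbabilityTheory Filter Topology Asymptotics

/-- The matroid represented by a matrix `A` over a field: its ground set is the set of all column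
indices, and a set of column indices is independent when the corresponding family of columns
is linearly independent (so two indices with equal columns are dependent). -/
def matrixMatroid {F R E : Type*} [Field F] [Finite E] (A : Matrix R E F) : Matroid E :=
  (IndepMatroid.ofFinite (E := Set.univ) Set.finite_univ
    (fun S : Set E => LinearIndepOn F (fun j => A.col j) S)
    (linearIndepOn_empty F _)
    (fun _ _ hJ hIJ => hJ.mono hIJ)
    (by
      intro I J hI hJ hlt
      by_contra hcon
      push Not at hcon
      have hsub : (fun j => A.col j) '' J ⊆
          (Submodule.span F ((fun j => A.col j) '' I) : Set (R → F)) := by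
        rintro _ ⟨e, he, rfl⟩
        by_contra hns
        have heI : e ∉ I := fun h => hns (Submodule.subset_span ⟨e, h, rfl⟩)
        exact hcon e he heI (hI.insert hns)
      have hle := Submodule.span_le.2 hsub
      have : Module.Finite F (Submodule.span F ((fun j => A.col j) '' I)) :=
        FiniteDimensional.span_of_finite F (Set.toFinite _)
      have h1 := Submodule.finrank_mono hle
      have hr : ∀ K : Set E, LinearIndepOn F (fun j => A.col j) K →
          Module.finrank F (Submodule.span F ((fun j => A.col j) '' K)) = K.ncard := by
        intro K hK
        have : Fintype K := Fintype.ofFinite K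
        have := finrank_span_eq_card (R := F) (b := fun j : K => A.col j) hK
        rw [Set.image_eq_range, this, ← Nat.card_eq_fintype_card, Nat.card_coe_set_eq]
      rw [hr I hI, hr J hJ] at h1
      omega)
    (fun _ _ => Set.subset_univ _)).matroid

/-- The matrix `A_m = [v₁, …, v_m]` formed by the first `m` vectors of a sequence
(the sequence is indexed from `0`). -/
def firstColumns {F : Type*} {n : ℕ} (v : ℕ → Fin n → F) (m : ℕ) : Matrix (Fin n) (Fin m) F :=
  Matrix.of fun i j => v j i

/-- `M` has a circuit of length `k`. -/
def HasCircuitOfLength {E : Type*} (M : Matroid E) (k : ℕ) : Prop :=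
  ∃ C : Set E, M.IsCircuit C ∧ C.encard = k

/-- The smallest `m` such that the matroid represented by the first `m` vectors of the sequence
has a circuit of length `k`; it is `⊤` if there is no such `m`. -/
noncomputable def circuitTime {F : Type*} [Field F] {n : ℕ} (v : ℕ → Fin n → F) (k : ℕ) : ℕ∞ :=
  sInf ((fun m : ℕ => (m : ℕ∞)) '' {m | HasCircuitOfLength (matrixMatroid (firstColumns v m)) k})

/-- The extended real number underlying an extended natural number. -/
noncomputable def enatToEReal (t : ℕ∞) : EReal := ((t : ENNReal) : EReal)

/-- `X_n = Θ_p(x_n)`: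
`lim_{ε → 0+} limsup_{n → ∞} (P(X_n < ε x_n) + P(X_n > ε⁻¹ x_n)) = 0`. -/
def IsThetaInProbability {Ω : ℕ → Type*} [∀ n, MeasurableSpace (Ω n)] (P : ∀ n, Measure (Ω n))
    (X : ∀ n, Ω n → ℕ∞) (x : ℕ → ℝ) : Prop :=
  Tendsto (fun ε : ℝ => limsup (fun n =>
      P n {ω | enatToEReal (X n ω) < ((ε * x n : ℝ) : EReal)} +
      P n {ω | ((ε⁻¹ * x n : ℝ) : EReal) < enatToEReal (X n ω)}) atTop)
    (𝓝[>] 0) (𝓝 0)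

/-- Asymptotically almost surely `X_n ∼ x_n` (for nonnegative `x_n`): for every `ε > 0`, with
probability tending to `1`, `(1 - ε) x_n ≤ X_n ≤ (1 + ε) x_n`. -/
def IsAasEquivalent {Ω : ℕ → Type*} [∀ n, MeasurableSpace (Ω n)] (P : ∀ n, Measure (Ω n))
    (X : ∀ n, Ω n → ℕ∞) (x : ℕ → ℝ) : Prop :=
  ∀ ε : ℝ, 0 < ε → Tendsto (fun n =>
      P n {ω | (((1 - ε) * x n : ℝ) : EReal) ≤ enatToEReal (X n ω) ∧
        enatToEReal (X n ω) ≤ (((1 + ε) * x n : ℝ) : EReal)})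
    atTop (𝓝 1)

/-- The function `g_a(y)`, of interest for `y ≥ a > 0`; the value of `0 log 0` is `0`. -/
noncomputable def circuitRate (q a y : ℝ) : ℝ :=
  y * Real.log y + a * Real.log (q - 1) - a * Real.log a - (y - a) * Real.log (y - a) - Real.log q

/-!
A `k`-set of columns is a circuit exactly when `k - 1` of them are linearly independent and the last
one is a combination of these with nonzero coefficients; so a fixed `k`-set is a circuit with
probability `(q - 1) ^ (k - 1) / q ^ n`, times the probability, at least `1 / 4`, that `k - 1`
vectors are independent. The first moment method bounds `τ` from below.

For the second moment, condition on one circuit `S`. Of another `k`-set `T` this reveals only that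
`S ∩ T` is independent, and exposing the remaining vectors of `T` one at a time gives
`P(S and T are circuits) = p ^ 2 / P(S ∩ T is independent)`, where `p` is the probability of a
single circuit. Since `P(S ∩ T is independent) ≥ 1 - q ^ (|S ∩ T| - n)`, distinct sets are almost
uncorrelated: averaging `q ^ |S ∩ T|` over `T` through the expansion
`q ^ |S ∩ T| = ∑_{I ⊆ S ∩ T} (q - 1) ^ |I|`, the relative excess of the second moment is at most
`4 (1 + (q - 1) k / m) ^ k / q ^ n`, which tends to `0` as long as `k / m` stays away from `1`.
By Chebyshev's inequality, `τ` is therefore located where `C(m, k) (q - 1) ^ (k - 1) / q ^ n` passes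
from `o(1)` to `ω(1)`. If `k = o(n)` this happens on the scale `k q ^ (n / k)`, with the constant
supplied by Stirling's formula; if `k ∼ a n` and `m ∼ y n`, the logarithm of this quantity is
`(g_a(y) + o(1)) n`, and `g_a` is strictly increasing.
-/

section Probability

lemma measureReal_pi_inter_eq_mul_of_resample {ι : Type*} [Fintype ι] [DecidableEq ι]
    {X : ι → Type*} [∀ i, MeasurableSpace (X i)] (μ : ∀ i, Measure (X i))
    [∀ i, IsProbabilityMeasure (μ i)] (e : ι) {R Q : Set (∀ i, X i)} (hR : MeasurableSet R)
    (hQ : MeasurableSet Q) (hRe : ∀ w x, Function.update w e x ∈ R ↔ w ∈ R) {p : ℝ}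
    (hp : ∀ w ∈ R, (μ e).real (Function.update w e ⁻¹' Q) = p) :
    (Measure.pi μ).real (R ∩ Q) = (Measure.pi μ).real R * p := by
  rcases R.eq_empty_or_nonempty with rfl | ⟨w₀, hw₀⟩
  · simp only [Set.empty_inter, measureReal_empty, zero_mul]
  have hp0 : 0 ≤ p := hp w₀ hw₀ ▸ measureReal_nonneg
  have hmarg : ∫⋯∫⁻_{e}, (R ∩ Q).indicator 1 ∂μ =
      ∫⋯∫⁻_{e}, R.indicator (fun _ => ENNReal.ofReal p) ∂μ := by
    rw [lmarginal_singleton, lmarginal_singleton]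
    funext w
    by_cases hw : w ∈ R
    · have hpre : Function.update w e ⁻¹' (R ∩ Q) = Function.update w e ⁻¹' Q :=
        Set.ext fun x => and_iff_right ((hRe w x).2 hw)
      calc ∫⁻ x, (R ∩ Q).indicator 1 (Function.update w e x) ∂μ e
          = ∫⁻ x, (Function.update w e ⁻¹' (R ∩ Q)).indicator 1 x ∂μ e := rfl
        _ = ENNReal.ofReal p := by
            rw [hpre, lintegral_indicator_one (measurable_update w hQ), ← hp w hw,
              ofReal_measureReal]
        _ = ∫⁻ x, R.indicator (fun _ => ENNReal.ofReal p) (Function.update w e x) ∂μ e := by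
            simp only [Set.indicator, hRe, hw, if_true, lintegral_const, measure_univ, mul_one]
    · simp only [Set.indicator, Set.mem_inter_iff, hRe, hw, false_and, if_false]
  have h := lintegral_eq_of_lmarginal_eq {e}
    ((measurable_one (α := ENNReal)).indicator (hR.inter hQ)) (measurable_const.indicator hR) hmarg
  rw [lintegral_indicator_one (hR.inter hQ), lintegral_indicator_const hR, mul_comm] at h
  rw [measureReal_def, h, ENNReal.toReal_mul, ENNReal.toReal_ofReal hp0, measureReal_def]

variable {Ω ι : Type*} [MeasurableSpace Ω] {μ : Measure Ω} [IsProbabilityMeasure μ]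

lemma variance_sum_indicator (I : Finset ι) {A : ι → Set Ω} (hA : ∀ i, MeasurableSet (A i)) :
    Var[fun ω => ∑ i ∈ I, (A i).indicator (1 : Ω → ℝ) ω; μ] =
      ∑ i ∈ I, ∑ j ∈ I, μ.real (A i ∩ A j) - (∑ i ∈ I, μ.real (A i)) ^ 2 := by
  have hint (s : Set Ω) (hs : MeasurableSet s) : Integrable (s.indicator (1 : Ω → ℝ)) μ :=
    (integrable_const 1).indicator hs
  have hmean : ∫ ω, ∑ i ∈ I, (A i).indicator (1 : Ω → ℝ) ω ∂μ = ∑ i ∈ I, μ.real (A i) := by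
    rw [integral_finsetSum I fun i _ => hint _ (hA i)]
    exact Finset.sum_congr rfl fun i _ => integral_indicator_one (hA i)
  have hsq : ∫ ω, (∑ i ∈ I, (A i).indicator (1 : Ω → ℝ) ω) ^ 2 ∂μ =
      ∑ i ∈ I, ∑ j ∈ I, μ.real (A i ∩ A j) := by
    have hmul (i j : ι) (ω : Ω) : (A i).indicator (1 : Ω → ℝ) ω * (A j).indicator 1 ω =
        (A i ∩ A j).indicator 1 ω := by
      rw [Set.inter_indicator_one, Pi.mul_apply]
    simp only [sq, Finset.sum_mul_sum, hmul]
    rw [integral_finsetSum I fun i _ =>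
      integrable_finsetSum I fun j _ => hint _ ((hA i).inter (hA j))]
    refine Finset.sum_congr rfl fun i _ => ?_
    rw [integral_finsetSum I fun j _ => hint _ ((hA i).inter (hA j))]
    exact Finset.sum_congr rfl fun j _ => integral_indicator_one ((hA i).inter (hA j))
  have hL2 : MemLp (fun ω => ∑ i ∈ I, (A i).indicator (1 : Ω → ℝ) ω) 2 μ :=
    memLp_finsetSum I fun i _ => (memLp_const (1 : ℝ)).indicator (hA i)
  rw [variance_eq_sub hL2, hmean, ← hsq]
  rfl

lemma measureReal_biInter_compl_le (I : Finset ι) {A : ι → Set Ω}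
    (hA : ∀ i, MeasurableSet (A i)) {M δ : ℝ} (hM : 0 < M) (hsum : ∑ i ∈ I, μ.real (A i) = M)
    (hpair : ∑ i ∈ I, ∑ j ∈ I, μ.real (A i ∩ A j) ≤ M + (1 + δ) * M ^ 2) :
    μ.real (⋂ i ∈ I, (A i)ᶜ) ≤ M⁻¹ + δ := by
  let X : Ω → ℝ := fun ω => ∑ i ∈ I, (A i).indicator 1 ω
  have hmean : μ[X] = M := by
    rw [← hsum, integral_finsetSum I fun i _ => (integrable_const 1).indicator (hA i)]
    exact Finset.sum_congr rfl fun i _ => integral_indicator_one (hA i)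
  have hL2 : MemLp X 2 μ :=
    memLp_finsetSum I fun i _ => (memLp_const (1 : ℝ)).indicator (hA i)
  have hvar : Var[X; μ] ≤ M + δ * M ^ 2 := by
    rw [variance_sum_indicator I hA, hsum]
    linarith
  have hsub : (⋂ i ∈ I, (A i)ᶜ) ⊆ {ω | M ≤ |X ω - μ[X]|} := fun ω hω => by
    have hX0 : X ω = 0 := Finset.sum_eq_zero fun i hi =>
      Set.indicator_of_notMem (Set.mem_iInter₂.1 hω i hi) _
    rw [Set.mem_ofPred_eq, hX0, hmean, zero_sub, abs_neg, abs_of_pos hM]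
  calc μ.real (⋂ i ∈ I, (A i)ᶜ) ≤ μ.real {ω | M ≤ |X ω - μ[X]|} := measureReal_mono hsub
    _ ≤ Var[X; μ] / M ^ 2 :=
        ENNReal.toReal_le_of_le_ofReal (div_nonneg (variance_nonneg X μ) (sq_nonneg M))
          (meas_ge_le_variance_div_sq hL2 hM)
    _ ≤ (M + δ * M ^ 2) / M ^ 2 := by gcongr
    _ = M⁻¹ + δ := by field_simp

end Probability

section LinearCircuits

lemma eqOn_update_of_notMem {E V : Type*} [DecidableEq E] {J : Set E} {e : E} (w : E → V)
    (he : e ∉ J) (x : V) : Set.EqOn (Function.update w e x) w J := fun _ hi =>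
  Function.update_of_ne (ne_of_mem_of_not_mem hi he) x w

variable {F E V : Type*} [Field F] [AddCommGroup V] [Module F V] {w w' : E → V} {C J : Set E}
  {e : E}

/-- `C` indexes a circuit of the family of vectors `w`: a minimal linearly dependent subfamily. -/
def IsLinearCircuit (F : Type*) {E V : Type*} [Field F] [AddCommGroup V] [Module F V]
    (w : E → V) (C : Set E) : Prop :=
  Minimal (fun C => ¬ LinearIndepOn F w C) C

lemma IsLinearCircuit.linearIndepOn_of_ssubset (hC : IsLinearCircuit F w C) (hJ : J ⊂ C) :
    LinearIndepOn F w J :=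
  not_not.1 (hC.not_prop_of_ssubset hJ)

lemma isLinearCircuit_congr (h : Set.EqOn w w' C) :
    IsLinearCircuit F w C ↔ IsLinearCircuit F w' C := by
  have hsub {J : Set E} (hJ : J ⊆ C) : ¬ LinearIndepOn F w J ↔ ¬ LinearIndepOn F w' J :=
    not_congr (linearIndepOn_congr (h.mono hJ))
  exact and_congr (hsub subset_rfl)
    ⟨fun hC J hJ hJC => hC ((hsub hJC).2 hJ) hJC, fun hC J hJ hJC => hC ((hsub hJC).1 hJ) hJC⟩

lemma isLinearCircuit_insert_iff (he : e ∉ J) (hJ : LinearIndepOn F w J) :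
    IsLinearCircuit F w (insert e J) ↔
      ∃ l : E →₀ F, (l.support : Set E) = J ∧ Finsupp.linearCombination F w l = w e := by
  constructor
  · intro hC
    have hspan : w e ∈ Submodule.span F (w '' J) := by
      by_contra h
      exact hC.prop ((linearIndepOn_insert he).2 ⟨hJ, h⟩)
    obtain ⟨l, hl, hle⟩ := (Finsupp.mem_span_image_iff_linearCombination F).1 hspan
    have hlJ : (l.support : Set E) ⊆ J := hl
    refine ⟨l, hlJ.antisymm ?_, hle⟩
    have hdep : ¬ LinearIndepOn F w (insert e (l.support : Set E)) := fun h =>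
      ((linearIndepOn_insert fun hel => he (hlJ hel)).1 h).2
        ((Finsupp.mem_span_image_iff_linearCombination F).2
          ⟨l, Finsupp.mem_supported_support F l, hle⟩)
    exact (Set.insert_subset_insert_iff he).1 (hC.le_of_le hdep (Set.insert_subset_insert hlJ))
  · rintro ⟨l, hl, hle⟩
    have hlJ : l ∈ Finsupp.supported F F J := hl.subset
    refine ⟨fun h => ((linearIndepOn_insert he).1 h).2
      ((Finsupp.mem_span_image_iff_linearCombination F).2 ⟨l, hlJ, hle⟩), fun T hT hTJ => ?_⟩
    have heT : e ∈ T := by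
      by_contra heT
      exact hT (hJ.mono ((Set.subset_insert_iff_of_notMem heT).1 hTJ))
    have hT' : T \ {e} ⊆ J := Set.sdiff_singleton_subset_iff.2 hTJ
    have hspan : w e ∈ Submodule.span F (w '' (T \ {e})) := by
      by_contra h
      rw [← Set.insert_sdiff_self_of_mem heT] at hT
      exact hT ((linearIndepOn_insert (by simp)).2 ⟨hJ.mono hT', h⟩)
    obtain ⟨l', hl', hle'⟩ := (Finsupp.mem_span_image_iff_linearCombination F).1 hspan
    have hll' : l' = l := linearIndepOn_iffₛ.1 hJ l' (hl'.trans hT') l hlJ (hle'.trans hle.symm)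
    rw [hll', Finsupp.mem_supported, hl] at hl'
    exact Set.insert_subset heT (hl'.trans Set.sdiff_subset)

section Update

variable [DecidableEq E]

lemma linearIndepOn_update_insert_iff (he : e ∉ J) (hJ : LinearIndepOn F w J) (x : V) :
    LinearIndepOn F (Function.update w e x) (insert e J) ↔ x ∉ Submodule.span F (w '' J) := by
  have heq := eqOn_update_of_notMem w he x
  rw [linearIndepOn_insert he, linearIndepOn_congr heq, heq.image_eq, Function.update_self,
    and_iff_right hJ]

lemma isLinearCircuit_update_insert_iff (he : e ∉ J) (hJ : LinearIndepOn F w J) (x : V) :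
    IsLinearCircuit F (Function.update w e x) (insert e J) ↔
      ∃ l : E →₀ F, (l.support : Set E) = J ∧ Finsupp.linearCombination F w l = x := by
  have heq := eqOn_update_of_notMem w he x
  rw [isLinearCircuit_insert_iff he ((linearIndepOn_congr heq).2 hJ), Function.update_self]
  refine exists_congr fun l => and_congr_right fun hl => ?_
  have hsum : Finsupp.linearCombination F (Function.update w e x) l =
      Finsupp.linearCombination F w l := by
    simp only [Finsupp.linearCombination_apply]
    exact Finsupp.sum_congr fun i hi => by rw [heq (hl.subset hi)]
  rw [hsum]

end Update

lemma ncard_span_of_linearIndepOn [Fintype F] {J : Finset E}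
    (hJ : LinearIndepOn F w (J : Set E)) :
    (Submodule.span F (w '' (J : Set E)) : Set V).ncard = Fintype.card F ^ J.card := by
  have hrank := finrank_span_eq_card (R := F) hJ
  rw [← Set.image_eq_range, ← Nat.card_eq_fintype_card, Nat.card_coe_set_eq,
    Set.ncard_coe_finset] at hrank
  have : Module.Finite F (Submodule.span F (w '' (J : Set E))) :=
    FiniteDimensional.span_of_finite F (J.finite_toSet.image w)
  rw [← Nat.card_coe_set_eq, SetLike.coe_sort_coe, Module.natCard_eq_pow_finrank (K := F), hrank,
    Nat.card_eq_fintype_card]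

lemma ncard_linearCombination_of_support_eq [Fintype F] {J : Finset E}
    (hJ : LinearIndepOn F w (J : Set E)) :
    {x | ∃ l : E →₀ F, (l.support : Set E) = J ∧ Finsupp.linearCombination F w l = x}.ncard =
      (Fintype.card F - 1) ^ J.card := by
  classical
  have hsupp : {l : E →₀ F | (l.support : Set E) = J} =
      (J.finsupp fun _ => Finset.univ.erase (0 : F) : Finset (E →₀ F)) := by
    ext l
    simp only [Set.mem_ofPred_eq, Finset.coe_inj, Finset.mem_coe, Finset.mem_finsupp_iff,
      Finset.mem_erase, Finset.mem_univ, and_true, ← Finsupp.mem_support_iff]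
    exact Finset.Subset.antisymm_iff
  have hinj : Set.InjOn (Finsupp.linearCombination F w) {l | (l.support : Set E) = J} :=
    fun l hl l' hl' h => linearIndepOn_iffₛ.1 hJ l hl.subset l' hl'.subset h
  calc _ = (Finsupp.linearCombination F w '' {l | (l.support : Set E) = J}).ncard := rfl
    _ = (Fintype.card F - 1) ^ J.card := by
      rw [hinj.ncard_image, hsupp, Set.ncard_coe_finset, Finset.card_finsupp, Finset.prod_const,
        Finset.card_erase_of_mem (Finset.mem_univ 0), Finset.card_univ]

end LinearCircuits

section CircuitProbabilities

/-- The probability that `j` independent uniformly random vectors of an `n`-dimensional space over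
a field with `q` elements are linearly independent. -/
noncomputable def indepProb (q : ℝ) (n j : ℕ) : ℝ :=
  ∏ i ∈ Finset.range j, (1 - q ^ i / q ^ n)

/-- The probability that `k ≥ 1` independent uniformly random vectors of an `n`-dimensional space
over a field with `q` elements form a circuit: any `k - 1` of them are linearly independent, and the
last one is a combination of these with nonzero coefficients. -/
noncomputable def circuitProb (q : ℝ) (n k : ℕ) : ℝ :=
  indepProb q n (k - 1) * ((q - 1) ^ (k - 1) / q ^ n)

/-- The law of a family of independent uniformly random elements of `V`. -/
noncomputable abbrev uniformFamily (E V : Type*) [Fintype E] [MeasurableSpace V] :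
    Measure (E → V) :=
  Measure.pi fun _ => uniformOn Set.univ

lemma measureReal_uniformOn_univ {V : Type*} [Finite V] [MeasurableSpace V]
    [MeasurableSingletonClass V] (s : Set V) :
    (uniformOn Set.univ).real s = s.ncard / Nat.card V := by
  have := Fintype.ofFinite V
  rw [measureReal_def, uniformOn_univ, Measure.count_apply_finite s s.toFinite, ENNReal.toReal_div,
    ← Set.ncard_eq_toFinset_card s, Nat.card_eq_fintype_card]
  rfl

lemma natCard_eq_card_pow_finrank (F : Type*) {V : Type*} [Field F] [Fintype F] [AddCommGroup V]
    [Module F V] [Finite V] : (Nat.card V : ℝ) = (Fintype.card F : ℝ) ^ Module.finrank F V := by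
  rw [Module.natCard_eq_pow_finrank (K := F), Nat.card_eq_fintype_card, Nat.cast_pow]

variable {F E V : Type*} [Field F] [Fintype F] [AddCommGroup V] [Module F V] [Finite V]
  [MeasurableSpace V] [MeasurableSingletonClass V] [Fintype E]

section DecidableEq

variable [DecidableEq E]

lemma uniformFamily_real_inter_linearIndepOn_insert {R : Set (E → V)} {J : Finset E} {e : E}
    (he : e ∉ J) (hR : ∀ w x, Function.update w e x ∈ R ↔ w ∈ R)
    (hRJ : ∀ w ∈ R, LinearIndepOn F w (J : Set E)) :
    (uniformFamily E V).real (R ∩ {w | LinearIndepOn F w (insert e (J : Set E))}) =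
      (uniformFamily E V).real R *
        (1 - (Fintype.card F : ℝ) ^ J.card / (Fintype.card F : ℝ) ^ Module.finrank F V) := by
  refine measureReal_pi_inter_eq_mul_of_resample _ e .of_discrete .of_discrete hR fun w hw => ?_
  have hpre : Function.update w e ⁻¹' {w | LinearIndepOn F w (insert e (J : Set E))} =
      (Submodule.span F (w '' (J : Set E)) : Set V)ᶜ :=
    Set.ext fun x => linearIndepOn_update_insert_iff he (hRJ w hw) x
  rw [hpre, probReal_compl_eq_one_sub .of_discrete, measureReal_uniformOn_univ,
    ncard_span_of_linearIndepOn (hRJ w hw), natCard_eq_card_pow_finrank F, Nat.cast_pow]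

lemma uniformFamily_real_inter_isLinearCircuit_insert {R : Set (E → V)} {J : Finset E} {e : E}
    (he : e ∉ J) (hR : ∀ w x, Function.update w e x ∈ R ↔ w ∈ R)
    (hRJ : ∀ w ∈ R, LinearIndepOn F w (J : Set E)) :
    (uniformFamily E V).real (R ∩ {w | IsLinearCircuit F w (insert e (J : Set E))}) =
      (uniformFamily E V).real R *
        (((Fintype.card F : ℝ) - 1) ^ J.card / (Fintype.card F : ℝ) ^ Module.finrank F V) := by
  refine measureReal_pi_inter_eq_mul_of_resample _ e .of_discrete .of_discrete hR fun w hw => ?_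
  have hpre : Function.update w e ⁻¹' {w | IsLinearCircuit F w (insert e (J : Set E))} =
      {x | ∃ l : E →₀ F, (l.support : Set E) = J ∧ Finsupp.linearCombination F w l = x} :=
    Set.ext fun x => isLinearCircuit_update_insert_iff he (hRJ w hw) x
  rw [hpre, measureReal_uniformOn_univ, ncard_linearCombination_of_support_eq (hRJ w hw),
    natCard_eq_card_pow_finrank F, Nat.cast_pow, Nat.cast_pred Fintype.card_pos]

lemma uniformFamily_real_inter_linearIndepOn_union {R : Set (E → V)} {J D : Finset E}
    (hD : Disjoint J D) (hR : ∀ e ∈ D, ∀ w x, Function.update w e x ∈ R ↔ w ∈ R)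
    (hRJ : ∀ w ∈ R, LinearIndepOn F w (J : Set E)) :
    (uniformFamily E V).real (R ∩ {w | LinearIndepOn F w (J ∪ D : Finset E)}) *
        indepProb (Fintype.card F) (Module.finrank F V) J.card =
      (uniformFamily E V).real R *
        indepProb (Fintype.card F) (Module.finrank F V) (J.card + D.card) := by
  induction D using Finset.induction_on with
  | empty =>
    have hinter : R ∩ {w | LinearIndepOn F w (J ∪ ∅ : Finset E)} = R := by
      rw [Finset.union_empty]
      exact Set.inter_eq_left.2 hRJ
    rw [hinter, Finset.card_empty, add_zero]
  | insert e D heD ih =>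
    rw [Finset.disjoint_insert_right] at hD
    have heJD : e ∉ J ∪ D := by simp only [Finset.mem_union, hD.1, heD, or_self, not_false_iff]
    have hind : {w : E → V | LinearIndepOn F w (J ∪ insert e D : Finset E)} =
        {w | LinearIndepOn F w (J ∪ D : Finset E)} ∩
          {w | LinearIndepOn F w (insert e ((J ∪ D : Finset E) : Set E))} := by
      rw [Finset.union_insert, Finset.coe_insert]
      exact (Set.inter_eq_right.2 fun w hw => hw.mono (Set.subset_insert _ _)).symm
    have hstep := uniformFamily_real_inter_linearIndepOn_insert (F := F) (V := V)
      (R := R ∩ {w | LinearIndepOn F w (J ∪ D : Finset E)}) heJD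
      (fun w x => and_congr (hR e (Finset.mem_insert_self e D) w x)
        (linearIndepOn_congr (eqOn_update_of_notMem w heJD x)))
      (fun w hw => hw.2)
    rw [hind, ← Set.inter_assoc, hstep, mul_right_comm,
      ih hD.2 fun e' he' => hR e' (Finset.mem_insert_of_mem he'),
      Finset.card_insert_of_notMem heD, Finset.card_union_of_disjoint hD.2, mul_assoc]
    exact congrArg _ (Finset.prod_range_succ _ _).symm

lemma uniformFamily_real_inter_isLinearCircuit {R : Set (E → V)} {J T : Finset E} (hJT : J ⊂ T)
    (hR : ∀ e ∈ T \ J, ∀ w x, Function.update w e x ∈ R ↔ w ∈ R)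
    (hRJ : ∀ w ∈ R, LinearIndepOn F w (J : Set E)) :
    (uniformFamily E V).real (R ∩ {w | IsLinearCircuit F w T}) *
        indepProb (Fintype.card F) (Module.finrank F V) J.card =
      (uniformFamily E V).real R * circuitProb (Fintype.card F) (Module.finrank F V) T.card := by
  obtain ⟨e, heT, heJ⟩ := Finset.exists_of_ssubset hJT
  set D := (T \ J).erase e with hD
  have hJD : Disjoint J D := Finset.disjoint_sdiff.mono_right (Finset.erase_subset _ _)
  have heJD : e ∉ J ∪ D := by simp only [hD, Finset.mem_union, heJ, Finset.notMem_erase, or_self,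
    not_false_iff]
  have hT : insert e (J ∪ D) = T := by
    rw [← Finset.union_insert, hD, Finset.insert_erase (Finset.mem_sdiff.2 ⟨heT, heJ⟩),
      Finset.union_sdiff_of_subset hJT.subset]
  have hTcard : T.card - 1 = J.card + D.card := by
    rw [← hT, Finset.card_insert_of_notMem heJD, Nat.add_sub_cancel,
      Finset.card_union_of_disjoint hJD]
  have hunion := uniformFamily_real_inter_linearIndepOn_union (V := V) (R := R) hJD
    (fun i hi => hR i (Finset.mem_of_mem_erase hi)) hRJ
  have hlast := uniformFamily_real_inter_isLinearCircuit_insert (F := F)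
    (R := R ∩ {w | LinearIndepOn F w (J ∪ D : Finset E)}) heJD
    (fun w x => and_congr (hR e (Finset.mem_sdiff.2 ⟨heT, heJ⟩) w x)
      (linearIndepOn_congr (eqOn_update_of_notMem w heJD x)))
    (fun w hw => hw.2)
  have hsub : {w : E → V | IsLinearCircuit F w T} ⊆ {w | LinearIndepOn F w (J ∪ D : Finset E)} :=
    fun w hw => hw.linearIndepOn_of_ssubset
      (Finset.coe_ssubset.2 (hT ▸ Finset.ssubset_insert heJD))
  rw [← Finset.coe_insert, hT, Set.inter_assoc, Set.inter_eq_right.2 hsub,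
    Finset.card_union_of_disjoint hJD, ← hTcard] at hlast
  rw [hlast, mul_right_comm, hunion, ← hTcard, circuitProb, mul_assoc]

end DecidableEq

lemma uniformFamily_real_isLinearCircuit {S : Finset E} (hS : S.Nonempty) :
    (uniformFamily E V).real {w | IsLinearCircuit F w S} =
      circuitProb (Fintype.card F) (Module.finrank F V) S.card := by
  classical
  have h := uniformFamily_real_inter_isLinearCircuit (F := F) (V := V) (R := Set.univ)
    (Finset.empty_ssubset.2 hS) (fun _ _ _ _ => Iff.rfl)
    (fun w _ => by simpa only [Finset.coe_empty] using linearIndepOn_empty F w)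
  rwa [Set.univ_inter, probReal_univ, one_mul, Finset.card_empty, indepProb, Finset.prod_range_zero,
    mul_one] at h

lemma uniformFamily_real_isLinearCircuit_inter [DecidableEq E] {S T : Finset E} (hST : ¬ S ⊆ T)
    (hTS : ¬ T ⊆ S) :
    (uniformFamily E V).real ({w | IsLinearCircuit F w S} ∩ {w | IsLinearCircuit F w T}) *
        indepProb (Fintype.card F) (Module.finrank F V) (S ∩ T).card =
      circuitProb (Fintype.card F) (Module.finrank F V) S.card *
        circuitProb (Fintype.card F) (Module.finrank F V) T.card := by
  have hS : S.Nonempty := Finset.nonempty_of_ne_empty fun h => hST (h ▸ Finset.empty_subset T)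
  have hinter {U W : Finset E} (h : ¬ U ⊆ W) : U ∩ W ⊂ U :=
    Finset.inter_subset_left.ssubset_of_ne fun h' => h (Finset.inter_eq_left.1 h')
  rw [uniformFamily_real_inter_isLinearCircuit (Finset.inter_comm T S ▸ hinter hTS)
    (fun e he w x => isLinearCircuit_congr (eqOn_update_of_notMem w (by
      rw [Finset.sdiff_inter_self_right] at he
      exact (Finset.mem_sdiff.1 he).2) x))
    (fun w hw => hw.linearIndepOn_of_ssubset (Finset.coe_ssubset.2 (hinter hST))),
    uniformFamily_real_isLinearCircuit hS]

end CircuitProbabilities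

section Bounds

lemma indepProb_succ (q : ℝ) (n j : ℕ) :
    indepProb q n (j + 1) = indepProb q n j * (1 - q ^ j / q ^ n) :=
  Finset.prod_range_succ _ _

lemma indepProb_le_one {q : ℝ} (hq : 1 ≤ q) (n j : ℕ) : indepProb q n j ≤ 1 := by
  have : 0 < q := one_pos.trans_le hq
  rcases lt_or_ge n j with hnj | hjn
  · refine (Finset.prod_eq_zero (Finset.mem_range.2 hnj) ?_).trans_le zero_le_one
    rw [div_self (by positivity), sub_self]
  · refine Finset.prod_le_one (fun i hi => sub_nonneg.2 ?_) fun i _ => sub_le_self _ (by positivity)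
    exact div_le_one_of_le₀ (pow_le_pow_right₀ hq ((Finset.mem_range.1 hi).le.trans hjn))
      (by positivity)

variable {q : ℝ} {n j k : ℕ}

lemma one_sub_pow_div_pow_le_indepProb (hq : 2 ≤ q) (hj : j ≤ n) :
    1 - q ^ j / q ^ n ≤ indepProb q n j := by
  induction j with
  | zero => simpa only [indepProb, Finset.prod_range_zero, sub_le_self_iff] using by positivity
  | succ j ih =>
    have hle : q ^ (j + 1) / q ^ n ≤ 1 :=
      div_le_one_of_le₀ (pow_le_pow_right₀ (by linarith) hj) (by positivity)
    rw [pow_succ', mul_div_assoc] at hle ⊢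
    set x := q ^ j / q ^ n
    have hx : 0 ≤ x := by positivity
    have hx1 : x ≤ 1 := by nlinarith
    calc 1 - q * x ≤ (1 - x) * (1 - x) := by nlinarith
      _ ≤ indepProb q n j * (1 - x) :=
          mul_le_mul_of_nonneg_right (ih (Nat.le_of_succ_le hj)) (sub_nonneg.2 hx1)
      _ = indepProb q n (j + 1) := (indepProb_succ q n j).symm

lemma one_fourth_le_indepProb (hq : 2 ≤ q) (hj : j ≤ n) : 1 / 4 ≤ indepProb q n j := by
  cases j with
  | zero => norm_num [indepProb]
  | succ j =>
    have hind := one_sub_pow_div_pow_le_indepProb hq (Nat.le_of_succ_le hj)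
    have hhalf : q ^ j / q ^ n ≤ 1 / 2 := by
      rw [div_le_div_iff₀ (by positivity) two_pos, one_mul]
      calc q ^ j * 2 ≤ q ^ j * q := by gcongr
        _ = q ^ (j + 1) := (pow_succ q j).symm
        _ ≤ q ^ n := pow_le_pow_right₀ (by linarith) hj
    rw [indepProb_succ]
    nlinarith

lemma circuitProb_le (hq : 1 ≤ q) : circuitProb q n k ≤ (q - 1) ^ (k - 1) / q ^ n :=
  mul_le_of_le_one_left (div_nonneg (pow_nonneg (by linarith) _) (by positivity))
    (indepProb_le_one hq n _)

lemma le_circuitProb (hq : 2 ≤ q) (hk : k ≤ n + 1) :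
    (q - 1) ^ (k - 1) / q ^ n / 4 ≤ circuitProb q n k := by
  rw [circuitProb, div_eq_mul_one_div _ (4 : ℝ), mul_comm]
  exact mul_le_mul_of_nonneg_right (one_fourth_le_indepProb hq (by omega))
    (div_nonneg (pow_nonneg (by linarith) _) (by positivity))

end Bounds

section Overlaps

lemma choose_sub_sub_le {m k i : ℕ} (hkm : k ≤ m) (hi : i ≤ k) :
    ((m - i).choose (k - i) : ℝ) ≤ (k / m : ℝ) ^ i * m.choose k := by
  induction i with
  | zero => simp only [Nat.sub_zero, pow_zero, one_mul, le_refl]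
  | succ i ih =>
    obtain ⟨a, rfl⟩ : ∃ a, m = a + 1 + i := ⟨m - (i + 1), by omega⟩
    obtain ⟨b, rfl⟩ : ∃ b, k = b + 1 + i := ⟨k - (i + 1), by omega⟩
    have ih' := ih (by omega)
    have hab : (b : ℝ) ≤ a := by exact_mod_cast (by omega : b ≤ a)
    have habsorb : ((a : ℝ) + 1) * a.choose b = (a + 1).choose (b + 1) * (b + 1) := by
      exact_mod_cast Nat.add_one_mul_choose_eq a b
    have hratio : ((b : ℝ) + 1) / (a + 1) ≤ (b + 1 + i : ℕ) / (a + 1 + i : ℕ) := by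
      push_cast
      rw [div_le_div_iff₀ (by positivity) (by positivity)]
      nlinarith [(Nat.cast_nonneg i : (0 : ℝ) ≤ i)]
    rw [Nat.add_sub_cancel, Nat.add_sub_cancel] at ih'
    rw [show a + 1 + i - (i + 1) = a by omega, show b + 1 + i - (i + 1) = b by omega]
    calc (a.choose b : ℝ) = (b + 1) / (a + 1) * (a + 1).choose (b + 1) := by
          field_simp
          linarith
      _ ≤ _ := by
          rw [pow_succ', mul_assoc]
          gcongr

lemma pow_card_inter_eq_sum_powerset {R E : Type*} [CommRing R] [DecidableEq E] (z : R)
    (S T : Finset E) :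
    z ^ (S ∩ T).card = ∑ I ∈ S.powerset, if I ⊆ T then (z - 1) ^ I.card else 0 := by
  have hfilter : S.powerset.filter (· ⊆ T) = (S ∩ T).powerset := by
    ext I
    simp only [Finset.mem_filter, Finset.mem_powerset, Finset.subset_inter_iff]
  rw [← Finset.sum_filter, hfilter]
  simpa only [one_pow, mul_one, sub_add_cancel] using
    (Finset.sum_pow_mul_eq_add_pow (z - 1) 1 (S ∩ T)).symm

lemma sum_pow_card_inter_le {E : Type*} [Fintype E] [DecidableEq E] {k : ℕ} {z : ℝ} (hz : 1 ≤ z)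
    (hkE : k ≤ Fintype.card E) {S : Finset E} (hS : S.card ≤ k) :
    ∑ T ∈ (Finset.univ : Finset E).powersetCard k, z ^ (S ∩ T).card ≤
      (Fintype.card E).choose k * (1 + (z - 1) * (k / Fintype.card E)) ^ S.card := by
  simp only [pow_card_inter_eq_sum_powerset]
  rw [Finset.sum_comm, add_comm (1 : ℝ), ← Finset.sum_pow_mul_eq_add_pow _ 1 S, Finset.mul_sum]
  refine Finset.sum_le_sum fun I hI => ?_
  have hIk : I.card ≤ k := (Finset.card_le_card (Finset.mem_powerset.1 hI)).trans hS
  have hz' : 0 ≤ (z - 1) ^ I.card := pow_nonneg (by linarith) _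
  rw [← Finset.sum_filter, Finset.sum_const, nsmul_eq_mul,
    Finset.card_filter_powersetCard_subset I _ k (Finset.subset_univ I) hIk, Finset.card_univ]
  calc _ ≤ ((k / Fintype.card E : ℝ) ^ I.card * (Fintype.card E).choose k) * (z - 1) ^ I.card :=
        mul_le_mul_of_nonneg_right (choose_sub_sub_le hkE hIk) hz'
    _ = _ := by rw [mul_comm (_ ^ _) (_ : ℝ), one_pow, mul_one, mul_pow]; ring

end Overlaps

section Moments

/-- The expected number of `k`-circuits among `m` independent uniformly random vectors of an
`n`-dimensional space over a field with `q` elements, up to a factor between `1 / 4` and `1` that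
accounts for the probability that `k - 1` vectors are linearly independent. -/
noncomputable def firstMoment (q : ℝ) (n m k : ℕ) : ℝ :=
  m.choose k * ((q - 1) ^ (k - 1) / q ^ n)

/-- An upper bound for the relative excess of the second moment of the number of `k`-circuits
among `m` vectors over the value it would have if the events that distinct `k`-sets are circuits
were pairwise independent. -/
noncomputable def overlapExcess (q : ℝ) (n m k : ℕ) : ℝ :=
  4 * (1 + (q - 1) * (k / m)) ^ k / q ^ n

lemma firstMoment_pos {q : ℝ} (hq : 1 < q) (n : ℕ) {m k : ℕ} (hkm : k ≤ m) :
    0 < firstMoment q n m k :=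
  mul_pos (by exact_mod_cast Nat.choose_pos hkm)
    (div_pos (pow_pos (sub_pos.2 hq) _) (pow_pos (one_pos.trans hq) _))

variable (F E V : Type*) [Field F] [Fintype F] [AddCommGroup V] [Module F V] [Finite V]
  [MeasurableSpace V] [MeasurableSingletonClass V] [Fintype E] {k : ℕ}

lemma two_le_card_field (F : Type*) [Field F] [Fintype F] : (2 : ℝ) ≤ Fintype.card F := by
  exact_mod_cast Fintype.one_lt_card (α := F)

lemma sum_uniformFamily_real_isLinearCircuit (hk : 1 ≤ k) :
    ∑ S ∈ (Finset.univ : Finset E).powersetCard k,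
        (uniformFamily E V).real {w | IsLinearCircuit F w S} =
      (Fintype.card E).choose k * circuitProb (Fintype.card F) (Module.finrank F V) k := by
  classical
  rw [Finset.sum_eq_card_nsmul fun S hS => ?_, Finset.card_powersetCard, nsmul_eq_mul,
    Finset.card_univ]
  rw [Finset.mem_powersetCard_univ] at hS
  rw [uniformFamily_real_isLinearCircuit (Finset.card_pos.1 (hS ▸ hk)), hS]

lemma uniformFamily_real_exists_isLinearCircuit_le (hk : 1 ≤ k) :
    (uniformFamily E V).real {w | ∃ S : Finset E, S.card = k ∧ IsLinearCircuit F w S} ≤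
      firstMoment (Fintype.card F) (Module.finrank F V) (Fintype.card E) k := by
  have hunion : {w : E → V | ∃ S : Finset E, S.card = k ∧ IsLinearCircuit F w S} =
      ⋃ S ∈ (Finset.univ : Finset E).powersetCard k, {w | IsLinearCircuit F w S} := by
    ext w
    simp only [Set.mem_ofPred_eq, Set.mem_iUnion, Finset.mem_powersetCard_univ, exists_prop]
  rw [hunion]
  refine (measureReal_biUnion_finset_le _ _).trans ?_
  rw [sum_uniformFamily_real_isLinearCircuit F E V hk]
  exact mul_le_mul_of_nonneg_left (circuitProb_le (one_le_two.trans (two_le_card_field F)))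
    (Nat.cast_nonneg _)

variable {F E V}

lemma uniformFamily_real_isLinearCircuit_inter_le [DecidableEq E]
    (hkn : k ≤ Module.finrank F V + 1) {S T : Finset E} (hS : S.card = k) (hT : T.card = k)
    (hne : S ≠ T) :
    (uniformFamily E V).real ({w | IsLinearCircuit F w S} ∩ {w | IsLinearCircuit F w T}) ≤
      circuitProb (Fintype.card F) (Module.finrank F V) k ^ 2 *
        (1 + 4 * ((Fintype.card F : ℝ) ^ (S ∩ T).card /
          (Fintype.card F : ℝ) ^ Module.finrank F V)) := by
  have hST : ¬ S ⊆ T := fun h => hne (Finset.eq_of_subset_of_card_le h (hT.trans hS.symm).le)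
  have hTS : ¬ T ⊆ S := fun h => hne (Finset.eq_of_subset_of_card_le h (hS.trans hT.symm).le).symm
  have hcard : (S ∩ T).card ≤ Module.finrank F V := by
    have : (S ∩ T).card < k := hS ▸ Finset.card_lt_card (Finset.inter_subset_left.ssubset_of_ne
      fun h => hST (Finset.inter_eq_left.1 h))
    omega
  have hpair := uniformFamily_real_isLinearCircuit_inter (F := F) (V := V) hST hTS
  have hlow := one_sub_pow_div_pow_le_indepProb (two_le_card_field F) hcard
  have hquarter := one_fourth_le_indepProb (two_le_card_field F) hcard
  rw [hS, hT, ← sq] at hpair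
  rw [← hpair, mul_assoc]
  refine le_mul_of_one_le_right measureReal_nonneg ?_
  have : 0 ≤ (Fintype.card F : ℝ) ^ (S ∩ T).card / (Fintype.card F : ℝ) ^ Module.finrank F V := by
    positivity
  nlinarith

lemma sum_uniformFamily_real_isLinearCircuit_inter_le (hkn : k ≤ Module.finrank F V + 1)
    (hkE : k ≤ Fintype.card E) {S : Finset E} (hS : S.card = k) :
    ∑ T ∈ (Finset.univ : Finset E).powersetCard k,
        (uniformFamily E V).real ({w | IsLinearCircuit F w S} ∩ {w | IsLinearCircuit F w T}) ≤
      (uniformFamily E V).real {w | IsLinearCircuit F w S} +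
        (1 + overlapExcess (Fintype.card F) (Module.finrank F V) (Fintype.card E) k) *
          ((Fintype.card E).choose k *
            circuitProb (Fintype.card F) (Module.finrank F V) k ^ 2) := by
  classical
  set q := (Fintype.card F : ℝ)
  set n := Module.finrank F V
  set p := circuitProb q n k
  have hterm : ∀ T ∈ (Finset.univ : Finset E).powersetCard k,
      (uniformFamily E V).real ({w | IsLinearCircuit F w S} ∩ {w | IsLinearCircuit F w T}) ≤
        (if S = T then (uniformFamily E V).real {w | IsLinearCircuit F w S} else 0) +
          (p ^ 2 + 4 * p ^ 2 / q ^ n * q ^ (S ∩ T).card) := fun T hT => by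
    split_ifs with hST
    · exact (measureReal_mono Set.inter_subset_left).trans
        (le_add_of_nonneg_right (by positivity))
    · rw [zero_add]
      refine (uniformFamily_real_isLinearCircuit_inter_le hkn hS
        (Finset.mem_powersetCard_univ.1 hT) hST).trans_eq ?_
      ring
  refine (Finset.sum_le_sum hterm).trans ?_
  rw [Finset.sum_add_distrib, Finset.sum_ite_eq, if_pos (Finset.mem_powersetCard_univ.2 hS),
    Finset.sum_add_distrib, Finset.sum_const, Finset.card_powersetCard, nsmul_eq_mul,
    Finset.card_univ, ← Finset.mul_sum, overlapExcess]
  gcongr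
  have hoverlap := sum_pow_card_inter_le (one_le_two.trans (two_le_card_field F)) hkE hS.le
  rw [hS] at hoverlap
  calc _ ≤ (Fintype.card E).choose k * p ^ 2 + 4 * p ^ 2 / q ^ n *
        ((Fintype.card E).choose k * (1 + (q - 1) * (k / Fintype.card E)) ^ k) := by gcongr
    _ = _ := by ring

variable (F E V) in
lemma uniformFamily_real_not_exists_isLinearCircuit_le (hk : 1 ≤ k)
    (hkn : k ≤ Module.finrank F V + 1) (hkE : k ≤ Fintype.card E) :
    (uniformFamily E V).real {w | ¬ ∃ S : Finset E, S.card = k ∧ IsLinearCircuit F w S} ≤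
      4 / firstMoment (Fintype.card F) (Module.finrank F V) (Fintype.card E) k +
        overlapExcess (Fintype.card F) (Module.finrank F V) (Fintype.card E) k := by
  have hq := two_le_card_field F
  have hsum := sum_uniformFamily_real_isLinearCircuit F E V hk
  set q := (Fintype.card F : ℝ)
  set n := Module.finrank F V
  set M := (Fintype.card E).choose k * circuitProb q n k
  have hinter : {w : E → V | ¬ ∃ S : Finset E, S.card = k ∧ IsLinearCircuit F w S} =
      ⋂ S ∈ (Finset.univ : Finset E).powersetCard k, {w | IsLinearCircuit F w S}ᶜ := by
    ext w
    simp only [Set.mem_ofPred_eq, Set.mem_iInter, Finset.mem_powersetCard_univ, not_exists, not_and,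
      Set.mem_compl_iff]
  have hmoment : firstMoment q n (Fintype.card E) k / 4 ≤ M := by
    rw [firstMoment, mul_div_assoc]
    exact mul_le_mul_of_nonneg_left (le_circuitProb hq hkn) (Nat.cast_nonneg _)
  have hmoment_pos := firstMoment_pos (one_lt_two.trans_le hq) n hkE
  have hpair : ∑ S ∈ (Finset.univ : Finset E).powersetCard k,
      ∑ T ∈ (Finset.univ : Finset E).powersetCard k, (uniformFamily E V).real
        ({w | IsLinearCircuit F w S} ∩ {w | IsLinearCircuit F w T}) ≤
      M + (1 + overlapExcess q n (Fintype.card E) k) * M ^ 2 := by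
    refine (Finset.sum_le_sum fun S hS => sum_uniformFamily_real_isLinearCircuit_inter_le hkn hkE
      (Finset.mem_powersetCard_univ.1 hS)).trans_eq ?_
    rw [Finset.sum_add_distrib, hsum, Finset.sum_const, Finset.card_powersetCard, nsmul_eq_mul,
      Finset.card_univ]
    ring
  rw [hinter]
  refine (measureReal_biInter_compl_le _ (fun _ => .of_discrete)
    ((div_pos hmoment_pos four_pos).trans_le hmoment) hsum hpair).trans ?_
  rw [← inv_div]
  gcongr

end Moments

section CircuitTime

lemma IsLinearCircuit.image {F E E' V : Type*} [Field F] [AddCommGroup V] [Module F V] {w : E' → V}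
    {f : E → E'} (hf : Function.Injective f) {C : Set E} (hC : IsLinearCircuit F (w ∘ f) C) :
    IsLinearCircuit F w (f '' C) := by
  refine ⟨fun h => hC.prop (h.comp_of_image hf.injOn), fun D hD hDC => ?_⟩
  obtain ⟨J, hJC, rfl⟩ := Set.subset_image_iff.1 hDC
  exact Set.image_mono (hC.le_of_le (fun h => hD (h.image_of_comp f w)) hJC)

lemma enatToEReal_mono : Monotone enatToEReal := fun a b h => by
  rw [enatToEReal, enatToEReal]
  exact_mod_cast h

lemma enatToEReal_natCast (m : ℕ) : enatToEReal m = ((m : ℝ) : EReal) := by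
  rw [enatToEReal, ENat.toENNReal_coe]
  rfl

lemma le_floor_of_enatToEReal_lt {t : ℕ∞} {y : ℝ} (h : enatToEReal t < y) : t ≤ ⌊y⌋₊ := by
  refine Order.lt_add_one_iff_of_not_isMax (by simp) |>.1 (lt_of_not_ge fun hle => ?_)
  have hlt := (enatToEReal_mono hle).trans_lt h
  rw [← Nat.cast_add_one, enatToEReal_natCast, EReal.coe_lt_coe_iff, Nat.cast_add_one] at hlt
  exact hlt.not_gt (Nat.lt_floor_add_one y)

lemma floor_lt_of_lt_enatToEReal {t : ℕ∞} {y : ℝ} (hy : 0 ≤ y) (h : y < enatToEReal t) :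
    (⌊y⌋₊ : ℕ∞) < t := lt_of_not_ge fun hle => by
  have hlt := h.trans_le (enatToEReal_mono hle)
  rw [enatToEReal_natCast, EReal.coe_lt_coe_iff] at hlt
  exact hlt.not_ge (Nat.floor_le hy)

lemma hasLaw_uniformFamily {Ω V : Type*} [MeasurableSpace Ω] [MeasurableSpace V] {P : Measure Ω}
    {X : ℕ → Ω → V} (hindep : iIndepFun X P) (hunif : ∀ i, HasLaw (X i) (uniformOn Set.univ) P)
    (m : ℕ) : HasLaw (fun ω (i : Fin m) => X i ω) (uniformFamily (Fin m) V) P :=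
  iIndepFun.hasLaw_pi (fun i => hunif i) (hindep.precomp Fin.val_injective)

variable {F : Type*} [Field F] {n : ℕ}

lemma isCircuit_matrixMatroid_firstColumns_iff (v : ℕ → Fin n → F) (m : ℕ) {C : Set (Fin m)} :
    (matrixMatroid (firstColumns v m)).IsCircuit C ↔
      IsLinearCircuit F (fun j : Fin m => v j) C := by
  have hdep : (matrixMatroid (firstColumns v m)).Dep =
      fun C => ¬ LinearIndepOn F (fun j : Fin m => v j) C :=
    funext fun C => propext (Matroid.not_indep_iff C.subset_univ).symm
  rw [Matroid.IsCircuit, hdep, IsLinearCircuit]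

lemma hasCircuitOfLength_firstColumns_iff (v : ℕ → Fin n → F) (m k : ℕ) :
    HasCircuitOfLength (matrixMatroid (firstColumns v m)) k ↔
      ∃ S : Finset (Fin m), S.card = k ∧ IsLinearCircuit F (fun j : Fin m => v j) S := by
  simp only [HasCircuitOfLength, isCircuit_matrixMatroid_firstColumns_iff]
  constructor
  · rintro ⟨C, hC, hk⟩
    lift C to Finset (Fin m) using C.toFinite
    exact ⟨C, by exact_mod_cast (Set.encard_coe_eq_coe_finsetCard C).symm.trans hk, hC⟩
  · rintro ⟨S, rfl, hS⟩
    exact ⟨S, hS, Set.encard_coe_eq_coe_finsetCard S⟩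

lemma circuitTime_le_iff (v : ℕ → Fin n → F) (k m : ℕ) :
    circuitTime v k ≤ m ↔
      ∃ S : Finset (Fin m), S.card = k ∧ IsLinearCircuit F (fun j : Fin m => v j) S := by
  constructor
  · intro h
    obtain ⟨_, ⟨l, hl, rfl⟩, hlm⟩ := sInf_lt_iff.1 (h.trans_lt ENat.natCast_lt_succ)
    have hle : l ≤ m := Nat.lt_succ_iff.1 (Nat.cast_lt.1 hlm)
    obtain ⟨S, hS, hcirc⟩ := (hasCircuitOfLength_firstColumns_iff v l k).1 hl
    refine ⟨S.map (Fin.castLEEmb hle), by rw [Finset.card_map, hS], ?_⟩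
    rw [Finset.coe_map]
    exact hcirc.image (w := fun j : Fin m => v j) (Fin.castLEEmb hle).injective
  · exact fun h => sInf_le ⟨m, (hasCircuitOfLength_firstColumns_iff v m k).2 h, rfl⟩

variable [Fintype F] [MeasurableSpace F] [MeasurableSingletonClass F] {Ω : Type*}
  [MeasurableSpace Ω] {P : Measure Ω} {X : ℕ → Ω → (Fin n → F)} {k m : ℕ}

lemma measure_circuitTime_le_le (hindep : iIndepFun X P)
    (hunif : ∀ i, HasLaw (X i) (uniformOn Set.univ) P) (hk : 1 ≤ k) :
    P {ω | circuitTime (fun i => X i ω) k ≤ m} ≤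
      ENNReal.ofReal (firstMoment (Fintype.card F) n m k) := by
  have hmoment := uniformFamily_real_exists_isLinearCircuit_le F (Fin m) (Fin n → F) hk
  rw [Module.finrank_fin_fun, Fintype.card_fin] at hmoment
  simp only [circuitTime_le_iff]
  rw [(hasLaw_uniformFamily hindep hunif m).measure_eq (p := fun w =>
    ∃ S : Finset (Fin m), S.card = k ∧ IsLinearCircuit F w S) .of_discrete, ← ofReal_measureReal]
  exact ENNReal.ofReal_le_ofReal hmoment

lemma measure_lt_circuitTime_le (hindep : iIndepFun X P)
    (hunif : ∀ i, HasLaw (X i) (uniformOn Set.univ) P) (hk : 1 ≤ k) (hkn : k ≤ n + 1)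
    (hkm : k ≤ m) :
    P {ω | m < circuitTime (fun i => X i ω) k} ≤
      ENNReal.ofReal (4 / firstMoment (Fintype.card F) n m k +
        overlapExcess (Fintype.card F) n m k) := by
  have hmoment := uniformFamily_real_not_exists_isLinearCircuit_le F (Fin m) (Fin n → F) hk
    (by rwa [Module.finrank_fin_fun]) (by rwa [Fintype.card_fin])
  rw [Module.finrank_fin_fun, Fintype.card_fin] at hmoment
  simp only [← not_le, circuitTime_le_iff]
  rw [(hasLaw_uniformFamily hindep hunif m).measure_eq (p := fun w =>
    ¬ ∃ S : Finset (Fin m), S.card = k ∧ IsLinearCircuit F w S) .of_discrete, ← ofReal_measureReal]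
  exact ENNReal.ofReal_le_ofReal hmoment

lemma measure_enatToEReal_circuitTime_lt_le (hindep : iIndepFun X P)
    (hunif : ∀ i, HasLaw (X i) (uniformOn Set.univ) P) (hk : 1 ≤ k) (y : ℝ) :
    P {ω | enatToEReal (circuitTime (fun i => X i ω) k) < y} ≤
      ENNReal.ofReal (firstMoment (Fintype.card F) n ⌊y⌋₊ k) :=
  (measure_mono fun _ hω => le_floor_of_enatToEReal_lt hω).trans
    (measure_circuitTime_le_le hindep hunif hk)

lemma measure_lt_enatToEReal_circuitTime_le (hindep : iIndepFun X P)
    (hunif : ∀ i, HasLaw (X i) (uniformOn Set.univ) P) (hk : 1 ≤ k) (hkn : k ≤ n + 1) {y : ℝ}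
    (hy : 0 ≤ y) (hky : k ≤ ⌊y⌋₊) :
    P {ω | y < enatToEReal (circuitTime (fun i => X i ω) k)} ≤
      ENNReal.ofReal (4 / firstMoment (Fintype.card F) n ⌊y⌋₊ k +
        overlapExcess (Fintype.card F) n ⌊y⌋₊ k) :=
  (measure_mono fun _ hω => floor_lt_of_lt_enatToEReal hy hω).trans
    (measure_lt_circuitTime_le hindep hunif hk hkn hky)

end CircuitTime

section Tails

lemma tendsto_overlapExcess {q θ : ℝ} (hq : 1 < q) (hθ : θ < 1) {m k : ℕ → ℕ}
    (hkn : ∀ᶠ n in atTop, k n ≤ n + 1) (hkm : ∀ᶠ n in atTop, (k n : ℝ) ≤ θ * m n) :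
    Tendsto (fun n => overlapExcess q n (m n) (k n)) atTop (𝓝 0) := by
  have hq0 : 0 < q := one_pos.trans hq
  have hq1 : 0 < q - 1 := sub_pos.2 hq
  set r := 1 + (q - 1) * max θ 0
  have hr : 1 ≤ r := le_add_of_nonneg_right (by positivity)
  have hrq : r / q < 1 := by
    rw [div_lt_one hq0]
    nlinarith [max_lt hθ one_pos]
  have hgeom := (tendsto_pow_atTop_nhds_zero_of_lt_one (by positivity) hrq).const_mul (4 * r)
  rw [mul_zero] at hgeom
  refine squeeze_zero' (.of_forall fun n => ?_) ?_ hgeom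
  · unfold overlapExcess
    positivity
  filter_upwards [hkn, hkm] with n hkn hkm
  have hratio : (k n / m n : ℝ) ≤ max θ 0 :=
    div_le_of_le_mul₀ (Nat.cast_nonneg _) (le_max_right _ _)
      (hkm.trans (mul_le_mul_of_nonneg_right (le_max_left _ _) (Nat.cast_nonneg _)))
  have hbase : 1 + (q - 1) * (k n / m n : ℝ) ≤ r :=
    add_le_add_right (mul_le_mul_of_nonneg_left hratio hq1.le) 1
  calc overlapExcess q n (m n) (k n) ≤ 4 * r ^ k n / q ^ n := by
        unfold overlapExcess
        gcongr
    _ ≤ 4 * r ^ (n + 1) / q ^ n := by gcongr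
    _ = 4 * r * (r / q) ^ n := by
        rw [div_pow]
        ring

lemma isAasEquivalent_of_tails {Ω : ℕ → Type*} [∀ n, MeasurableSpace (Ω n)]
    {P : ∀ n, Measure (Ω n)} [∀ n, IsProbabilityMeasure (P n)] {X : ∀ n, Ω n → ℕ∞} {x : ℕ → ℝ}
    (hx : ∀ n, 0 ≤ x n)
    (hlow : ∀ᶠ ε : ℝ in 𝓝[>] 0, Tendsto (fun n =>
      P n {ω | enatToEReal (X n ω) < (((1 - ε) * x n : ℝ) : EReal)}) atTop (𝓝 0))
    (hupp : ∀ᶠ ε : ℝ in 𝓝[>] 0, Tendsto (fun n =>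
      P n {ω | (((1 + ε) * x n : ℝ) : EReal) < enatToEReal (X n ω)}) atTop (𝓝 0)) :
    IsAasEquivalent P X x := by
  intro ε hε
  obtain ⟨δ, hδlow, hδupp, -, hδε⟩ := (hlow.and (hupp.and (Ioo_mem_nhdsGT hε))).exists
  have htails := ENNReal.Tendsto.sub (tendsto_const_nhds (x := 1)) (hδlow.add hδupp)
    (.inl ENNReal.one_ne_top)
  rw [add_zero, tsub_zero] at htails
  refine tendsto_of_tendsto_of_tendsto_of_le_of_le htails tendsto_const_nhds (fun n => ?_)
    fun n => prob_le_one
  rw [tsub_le_iff_right, ← measure_univ (μ := P n)]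
  refine (measure_mono fun ω _ => ?_).trans
    ((measure_union_le _ _).trans (add_le_add le_rfl (measure_union_le _ _)))
  by_contra hω
  simp only [Set.mem_union, Set.mem_ofPred_eq, not_or, not_lt] at hω
  refine hω.1 ⟨le_trans ?_ hω.2.1, hω.2.2.trans ?_⟩ <;> rw [EReal.coe_le_coe_iff] <;>
    exact mul_le_mul_of_nonneg_right (by linarith) (hx n)

variable {F : Type*} [Field F] [Fintype F] [MeasurableSpace F] [MeasurableSingletonClass F]
  {Ω : ℕ → Type*} [∀ n, MeasurableSpace (Ω n)] {P : ∀ n, Measure (Ω n)}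
  {v : ∀ n, ℕ → Ω n → (Fin n → F)} {k : ℕ → ℕ} {y : ℕ → ℝ}

lemma tendsto_measure_circuitTime_lt (hindep : ∀ n, iIndepFun (v n) (P n))
    (hunif : ∀ n i, HasLaw (v n i) (uniformOn Set.univ) (P n)) (hk : ∀ᶠ n in atTop, 1 ≤ k n)
    (hmoment : Tendsto (fun n => firstMoment (Fintype.card F) n ⌊y n⌋₊ (k n)) atTop (𝓝 0)) :
    Tendsto (fun n => P n {ω | enatToEReal (circuitTime (fun i => v n i ω) (k n)) < y n})
      atTop (𝓝 0) := by
  have hbound := ENNReal.tendsto_ofReal hmoment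
  rw [ENNReal.ofReal_zero] at hbound
  refine tendsto_of_tendsto_of_tendsto_of_le_of_le' tendsto_const_nhds hbound
    (.of_forall fun _ => zero_le) ?_
  filter_upwards [hk] with n hk
  exact measure_enatToEReal_circuitTime_lt_le (hindep n) (hunif n) hk (y n)

lemma tendsto_measure_lt_circuitTime (hindep : ∀ n, iIndepFun (v n) (P n))
    (hunif : ∀ n i, HasLaw (v n i) (uniformOn Set.univ) (P n)) (hk : ∀ᶠ n in atTop, 1 ≤ k n)
    (hkn : ∀ᶠ n in atTop, k n ≤ n + 1) {θ : ℝ} (hθ : θ < 1)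
    (hky : ∀ᶠ n in atTop, (k n : ℝ) ≤ θ * ⌊y n⌋₊)
    (hmoment : Tendsto (fun n => firstMoment (Fintype.card F) n ⌊y n⌋₊ (k n)) atTop atTop) :
    Tendsto (fun n => P n {ω | y n < enatToEReal (circuitTime (fun i => v n i ω) (k n))})
      atTop (𝓝 0) := by
  have hexcess := tendsto_overlapExcess (one_lt_two.trans_le (two_le_card_field F)) hθ hkn hky
  have hbound := ENNReal.tendsto_ofReal ((hmoment.const_div_atTop 4).add hexcess)
  rw [add_zero, ENNReal.ofReal_zero] at hbound
  refine tendsto_of_tendsto_of_tendsto_of_le_of_le' tendsto_const_nhds hbound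
    (.of_forall fun _ => zero_le) ?_
  filter_upwards [hk, hkn, hky] with n hk hkn hky
  have hkfloor : k n ≤ ⌊y n⌋₊ := by
    exact_mod_cast hky.trans (mul_le_of_le_one_left (Nat.cast_nonneg _) hθ.le)
  exact measure_lt_enatToEReal_circuitTime_le (hindep n) (hunif n) hk hkn
    (Nat.pos_of_floor_pos (hk.trans hkfloor)).le hkfloor

end Tails

section SublinearLength

lemma factorial_le_exp_one_mul {k : ℕ} (hk : 1 ≤ k) :
    (k.factorial : ℝ) ≤ Real.exp 1 * k * (k / Real.exp 1) ^ k := by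
  obtain ⟨j, rfl⟩ : ∃ j, k = j + 1 := ⟨k - 1, by omega⟩
  have hseq : Stirling.stirlingSeq (j + 1) ≤ Stirling.stirlingSeq 1 :=
    Stirling.stirlingSeq'_antitone (Nat.zero_le j)
  have hsqrt : √((j + 1 : ℕ) : ℝ) ≤ (j + 1 : ℕ) := by
    rw [Real.sqrt_le_left (by positivity)]
    exact_mod_cast Nat.le_self_pow two_ne_zero _
  rw [Stirling.stirlingSeq_one, Stirling.stirlingSeq, Real.sqrt_mul zero_le_two,
    div_le_iff₀ (by positivity)] at hseq
  calc ((j + 1).factorial : ℝ)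
      ≤ Real.exp 1 * √((j + 1 : ℕ) : ℝ) * ((j + 1 : ℕ) / Real.exp 1) ^ (j + 1) := by
        refine hseq.trans_eq ?_
        field_simp
    _ ≤ _ := by gcongr

lemma rpow_natCast_div_pow {q : ℝ} (hq : 0 ≤ q) (n : ℕ) {k : ℕ} (hk : 1 ≤ k) :
    (q ^ (n / k : ℝ)) ^ k = q ^ n := by
  rw [← Real.rpow_mul_natCast hq, div_mul_cancel₀ _ (by positivity), Real.rpow_natCast]

lemma firstMoment_floor_mul_rpow_le {q c : ℝ} (hq : 1 ≤ q) (hc : 0 ≤ c) (n : ℕ) {k : ℕ}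
    (hk : 1 ≤ k) :
    firstMoment q n ⌊c * q ^ (n / k : ℝ)⌋₊ k ≤ c ^ k * (q - 1) ^ (k - 1) / k.factorial := by
  have : 0 ≤ q - 1 := sub_nonneg.2 hq
  have hchoose : (⌊c * q ^ (n / k : ℝ)⌋₊.choose k : ℝ) ≤ c ^ k * q ^ n / k.factorial := by
    refine (Nat.choose_le_pow_div k _).trans ?_
    rw [← rpow_natCast_div_pow (by linarith) n hk, ← mul_pow]
    gcongr
    exact Nat.floor_le (by positivity)
  calc firstMoment q n ⌊c * q ^ (n / k : ℝ)⌋₊ k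
      ≤ c ^ k * q ^ n / k.factorial * ((q - 1) ^ (k - 1) / q ^ n) := by
        unfold firstMoment
        gcongr
    _ = _ := by field_simp

lemma le_firstMoment_floor_mul_rpow {q c d : ℝ} (hq : 1 ≤ q) (hd : 0 ≤ d) (n : ℕ) {k : ℕ}
    (hk : 1 ≤ k) (hdc : k + d * q ^ (n / k : ℝ) ≤ c * q ^ (n / k : ℝ)) :
    d ^ k * (q - 1) ^ (k - 1) / k.factorial ≤ firstMoment q n ⌊c * q ^ (n / k : ℝ)⌋₊ k := by
  have : 0 ≤ q - 1 := sub_nonneg.2 hq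
  set m := ⌊c * q ^ (n / k : ℝ)⌋₊
  have hm : k + d * q ^ (n / k : ℝ) ≤ m + 1 := hdc.trans (Nat.lt_floor_add_one _).le
  have hkm : k ≤ m + 1 := by
    exact_mod_cast (le_add_of_nonneg_right (by positivity) : (k : ℝ) ≤ _).trans hm
  have hchoose : d ^ k * q ^ n / k.factorial ≤ m.choose k := by
    refine le_trans ?_ (Nat.pow_le_choose k m)
    rw [← rpow_natCast_div_pow (by linarith) n hk, ← mul_pow]
    gcongr
    rw [Nat.cast_sub hkm, Nat.cast_add_one]
    linarith
  calc d ^ k * (q - 1) ^ (k - 1) / k.factorial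
      = d ^ k * q ^ n / k.factorial * ((q - 1) ^ (k - 1) / q ^ n) := by field_simp
    _ ≤ firstMoment q n m k := by
        unfold firstMoment
        gcongr

lemma eventually_le_add_one_of_isLittleO {k : ℕ → ℕ}
    (hkn : (fun n => (k n : ℝ)) =o[atTop] fun n => (n : ℝ)) : ∀ᶠ n in atTop, k n ≤ n + 1 := by
  filter_upwards [hkn.bound one_pos] with n hn
  rw [one_mul, Real.norm_natCast, Real.norm_natCast] at hn
  exact (Nat.cast_le.1 hn).trans n.le_succ

lemma tendsto_rpow_natCast_div_atTop {q : ℝ} (hq : 1 < q) {k : ℕ → ℕ}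
    (hk : ∀ᶠ n in atTop, 1 ≤ k n) (hkn : (fun n => (k n : ℝ)) =o[atTop] fun n => (n : ℝ)) :
    Tendsto (fun n : ℕ => q ^ (n / k n : ℝ)) atTop atTop := by
  have hratio : Tendsto (fun n => (k n / n : ℝ)) atTop (𝓝[>] 0) := by
    refine tendsto_nhdsWithin_iff.2 ⟨hkn.tendsto_div_nhds_zero, ?_⟩
    filter_upwards [hk, eventually_gt_atTop 0] with n hk hn
    rw [Set.mem_Ioi]
    positivity
  refine (tendsto_rpow_atTop_of_base_gt_one q hq).comp ?_
  exact hratio.inv_tendsto_nhdsGT_zero.congr fun n => inv_div _ _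

lemma div_exp_one_mul_pow_div_factorial {q : ℝ} (hq : 1 < q) (c : ℝ) {k : ℕ} (hk : 1 ≤ k) :
    (c / (Real.exp 1 * (q - 1)) * k) ^ k * (q - 1) ^ (k - 1) / k.factorial =
      c ^ k / (q - 1) * ((k / Real.exp 1) ^ k / k.factorial) := by
  have hq1 : q - 1 ≠ 0 := (sub_pos.2 hq).ne'
  obtain ⟨j, rfl⟩ : ∃ j, k = j + 1 := ⟨k - 1, by omega⟩
  rw [Nat.add_sub_cancel]
  simp only [mul_pow, div_pow, pow_succ (q - 1)]
  field_simp

lemma div_exp_one_pow_div_factorial_le_one (k : ℕ) :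
    (k / Real.exp 1) ^ k / k.factorial ≤ 1 := by
  have hexp := Real.pow_div_factorial_le_exp k (Nat.cast_nonneg k) k
  rw [div_pow, div_right_comm, ← Real.exp_nat_mul, mul_one]
  exact div_le_one_of_le₀ hexp (Real.exp_pos _).le

lemma tendsto_firstMoment_zero_of_lt_one {q c : ℝ} (hq : 2 ≤ q) (hc0 : 0 ≤ c) (hc : c < 1)
    {k : ℕ → ℕ} (hk : Tendsto k atTop atTop) :
    Tendsto (fun n => firstMoment q n
      ⌊c / (Real.exp 1 * (q - 1)) * k n * q ^ (n / k n : ℝ)⌋₊ (k n)) atTop (𝓝 0) := by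
  have hq1 : 1 ≤ q - 1 := by linarith
  refine squeeze_zero' (.of_forall fun n => ?_) ?_
    ((tendsto_pow_atTop_nhds_zero_of_lt_one hc0 hc).comp hk)
  · unfold firstMoment
    positivity
  filter_upwards [hk.eventually_ge_atTop 1] with n hk
  calc _ ≤ c ^ k n / (q - 1) * ((k n / Real.exp 1) ^ k n / (k n).factorial) := by
        rw [← div_exp_one_mul_pow_div_factorial (by linarith) c hk]
        exact firstMoment_floor_mul_rpow_le (by linarith) (by positivity) n hk
    _ ≤ c ^ k n * 1 :=
        mul_le_mul (div_le_self (by positivity) hq1) (div_exp_one_pow_div_factorial_le_one _)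
          (by positivity) (by positivity)
    _ = c ^ k n := mul_one _

variable {q : ℝ} {k : ℕ → ℕ}

lemma eventually_add_mul_rpow_le {c d : ℝ} (hq : 1 < q) (hdc : d < c)
    (hk : ∀ᶠ n in atTop, 1 ≤ k n) (hkn : (fun n => (k n : ℝ)) =o[atTop] fun n => (n : ℝ)) :
    ∀ᶠ n in atTop, (k n : ℝ) + d * k n * q ^ (n / k n : ℝ) ≤ c * k n * q ^ (n / k n : ℝ) := by
  filter_upwards [(tendsto_rpow_natCast_div_atTop hq hk hkn).eventually_ge_atTop (1 / (c - d))]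
    with n hn
  rw [div_le_iff₀ (sub_pos.2 hdc)] at hn
  nlinarith [(Nat.cast_nonneg (k n) : (0 : ℝ) ≤ k n)]

lemma eventually_le_half_mul_floor {c : ℝ} (hq : 1 < q) (hc : 0 < c)
    (hk : ∀ᶠ n in atTop, 1 ≤ k n) (hkn : (fun n => (k n : ℝ)) =o[atTop] fun n => (n : ℝ)) :
    ∀ᶠ n in atTop, (k n : ℝ) ≤ 1 / 2 * ⌊c * k n * q ^ (n / k n : ℝ)⌋₊ := by
  filter_upwards [eventually_add_mul_rpow_le (d := 0) hq (by positivity : 0 < c / 2) hk hkn]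
    with n hn
  have hle : 2 * k n ≤ ⌊c * k n * q ^ (n / k n : ℝ)⌋₊ := by
    refine Nat.le_floor ?_
    push_cast
    linarith
  rw [one_div, inv_mul_eq_div, le_div_iff₀' two_pos]
  exact_mod_cast hle

lemma tendsto_firstMoment_atTop_of_one_lt {c : ℝ} (hq : 1 < q) (hc : 1 < c)
    (hk : Tendsto k atTop atTop) (hkn : (fun n => (k n : ℝ)) =o[atTop] fun n => (n : ℝ)) :
    Tendsto (fun n => firstMoment q n
      ⌊c / (Real.exp 1 * (q - 1)) * k n * q ^ (n / k n : ℝ)⌋₊ (k n)) atTop atTop := by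
  have hq1 : 0 < q - 1 := sub_pos.2 hq
  obtain ⟨d, hd, hdc⟩ := exists_between hc
  have hgeom : Tendsto (fun j : ℕ => d ^ j / j) atTop atTop := by
    have hinv : Tendsto (fun j : ℕ => (j : ℝ) ^ 1 / d ^ j) atTop (𝓝[>] 0) := by
      refine tendsto_nhdsWithin_iff.2 ⟨tendsto_pow_const_div_const_pow_of_one_lt 1 hd, ?_⟩
      filter_upwards [eventually_gt_atTop 0] with j hj
      rw [Set.mem_Ioi]
      positivity
    refine hinv.inv_tendsto_nhdsGT_zero.congr fun j => ?_
    rw [Pi.inv_apply, pow_one, inv_div]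
  refine tendsto_atTop_mono' _ ?_ ((hgeom.comp hk).const_mul_atTop
    (by positivity : 0 < 1 / (Real.exp 1 * (q - 1))))
  have hk1 := hk.eventually_ge_atTop 1
  filter_upwards [hk1, eventually_add_mul_rpow_le hq (div_lt_div_of_pos_right hdc
    (by positivity : 0 < Real.exp 1 * (q - 1))) hk1 hkn] with n hk hn
  calc 1 / (Real.exp 1 * (q - 1)) * (d ^ k n / k n)
      = d ^ k n / (q - 1) * ((k n / Real.exp 1) ^ k n /
          (Real.exp 1 * k n * (k n / Real.exp 1) ^ k n)) := by field_simp
    _ ≤ d ^ k n / (q - 1) * ((k n / Real.exp 1) ^ k n / (k n).factorial) := by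
        gcongr
        exact factorial_le_exp_one_mul hk
    _ ≤ _ := by
        rw [← div_exp_one_mul_pow_div_factorial hq d hk]
        exact le_firstMoment_floor_mul_rpow hq.le (by positivity) n hk hn

lemma eventually_firstMoment_add_le (hq : 1 < q) {k : ℕ} (hk : 1 ≤ k) {ε : ℝ} (hε : 0 < ε) :
    ∀ᶠ n : ℕ in atTop, k ≤ n + 1 ∧ k ≤ ⌊ε⁻¹ * q ^ (n / k : ℝ)⌋₊ ∧
      firstMoment q n ⌊ε * q ^ (n / k : ℝ)⌋₊ k +
        (4 / firstMoment q n ⌊ε⁻¹ * q ^ (n / k : ℝ)⌋₊ k +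
          overlapExcess q n ⌊ε⁻¹ * q ^ (n / k : ℝ)⌋₊ k) ≤
      ((q - 1) ^ (k - 1) / k.factorial + 4 * (2 ^ k * k.factorial / (q - 1) ^ (k - 1)) + 1) *
        ε ^ k := by
  have hq1 : 0 < q - 1 := sub_pos.2 hq
  have hone : ∀ᶠ _ : ℕ in atTop, 1 ≤ k := .of_forall fun _ => hk
  have hkn : (fun _ : ℕ => (k : ℝ)) =o[atTop] fun n => (n : ℝ) :=
    (isLittleO_const_id_atTop _).comp_tendsto tendsto_natCast_atTop_atTop
  have hkle := eventually_le_add_one_of_isLittleO hkn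
  have hcancel : ∀ c : ℝ, c / k * k = c := fun c => div_mul_cancel₀ c (by positivity)
  have hhalf := eventually_le_half_mul_floor hq (by positivity : 0 < ε⁻¹ / k) hone hkn
  have hgap := eventually_add_mul_rpow_le hq (div_lt_div_of_pos_right
    (half_lt_self (inv_pos.2 hε)) (by positivity : (0 : ℝ) < k)) hone hkn
  simp only [hcancel] at hhalf hgap
  have hexcess := (tendsto_overlapExcess hq one_half_lt_one hkle hhalf).eventually_le_const
    (pow_pos hε k)
  filter_upwards [hkle, hhalf, hgap, hexcess] with n hkle hhalf hgap hexcess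
  have hlow := firstMoment_floor_mul_rpow_le hq.le hε.le n hk
  have hupp := le_firstMoment_floor_mul_rpow hq.le (by positivity) n hk hgap
  refine ⟨hkle, ?_, ?_⟩
  · exact_mod_cast hhalf.trans (mul_le_of_le_one_left (Nat.cast_nonneg _) (by norm_num))
  calc _ ≤ ε ^ k * (q - 1) ^ (k - 1) / k.factorial +
        (4 / ((ε⁻¹ / 2) ^ k * (q - 1) ^ (k - 1) / k.factorial) + ε ^ k) := by gcongr
    _ = _ := by
      simp only [div_pow, inv_pow]
      field_simp
      ring

end SublinearLength

section ShortCircuits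

variable {F : Type*} [Field F] [Fintype F] [MeasurableSpace F] [MeasurableSingletonClass F]
  {Ω : ℕ → Type*} [∀ n, MeasurableSpace (Ω n)] {P : ∀ n, Measure (Ω n)}
  {v : ∀ n, ℕ → Ω n → (Fin n → F)}

lemma eventually_measure_circuitTime_tails_le (hindep : ∀ n, iIndepFun (v n) (P n))
    (hunif : ∀ n i, HasLaw (v n i) (uniformOn Set.univ) (P n)) {k : ℕ} (hk : 1 ≤ k) {ε : ℝ}
    (hε : 0 < ε) : ∀ᶠ n : ℕ in atTop,
      P n {ω | enatToEReal (circuitTime (fun i => v n i ω) k) <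
        ((ε * (Fintype.card F : ℝ) ^ (n / k : ℝ) : ℝ) : EReal)} +
      P n {ω | ((ε⁻¹ * (Fintype.card F : ℝ) ^ (n / k : ℝ) : ℝ) : EReal) <
        enatToEReal (circuitTime (fun i => v n i ω) k)} ≤
      ENNReal.ofReal ((((Fintype.card F : ℝ) - 1) ^ (k - 1) / k.factorial +
        4 * (2 ^ k * k.factorial / ((Fintype.card F : ℝ) - 1) ^ (k - 1)) + 1) * ε ^ k) := by
  have hq := one_lt_two.trans_le (two_le_card_field F)
  filter_upwards [eventually_firstMoment_add_le hq hk hε] with n ⟨hkn, hkm, hbound⟩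
  refine (add_le_add (measure_enatToEReal_circuitTime_lt_le (hindep n) (hunif n) hk _)
    (measure_lt_enatToEReal_circuitTime_le (hindep n) (hunif n) hk hkn (by positivity)
      hkm)).trans ?_
  have : 0 ≤ (Fintype.card F : ℝ) - 1 := (sub_pos.2 hq).le
  rw [← ENNReal.ofReal_add (by unfold firstMoment; positivity)
    (by unfold firstMoment overlapExcess; positivity)]
  exact ENNReal.ofReal_le_ofReal hbound

lemma isThetaInProbability_circuitTime (hindep : ∀ n, iIndepFun (v n) (P n))
    (hunif : ∀ n i, HasLaw (v n i) (uniformOn Set.univ) (P n)) {k : ℕ} (hk : 1 ≤ k) :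
    IsThetaInProbability P (fun n ω => circuitTime (fun i => v n i ω) k)
      fun n => (Fintype.card F : ℝ) ^ (n / k : ℝ) := by
  have hbound : Tendsto (fun ε : ℝ => ENNReal.ofReal
      ((((Fintype.card F : ℝ) - 1) ^ (k - 1) / k.factorial +
        4 * (2 ^ k * k.factorial / ((Fintype.card F : ℝ) - 1) ^ (k - 1)) + 1) * ε ^ k))
      (𝓝 0) (𝓝 0) := by
    refine (ENNReal.continuous_ofReal.comp (by fun_prop)).tendsto' _ _ ?_
    rw [Function.comp_apply, zero_pow (by omega), mul_zero, ENNReal.ofReal_zero]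
  refine tendsto_of_tendsto_of_tendsto_of_le_of_le' tendsto_const_nhds
    (hbound.mono_left nhdsWithin_le_nhds) (.of_forall fun _ => zero_le) ?_
  filter_upwards [self_mem_nhdsWithin] with ε hε
  exact limsup_le_of_le (h := eventually_measure_circuitTime_tails_le hindep hunif hk hε)

lemma isAasEquivalent_circuitTime_of_isLittleO (hindep : ∀ n, iIndepFun (v n) (P n))
    (hunif : ∀ n i, HasLaw (v n i) (uniformOn Set.univ) (P n)) {k : ℕ → ℕ}
    (hk : Tendsto k atTop atTop) (hkn : (fun n => (k n : ℝ)) =o[atTop] fun n => (n : ℝ)) :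
    IsAasEquivalent P (fun n ω => circuitTime (fun i => v n i ω) (k n)) fun n =>
      1 / (Real.exp 1 * ((Fintype.card F : ℝ) - 1)) *
        (k n * (Fintype.card F : ℝ) ^ (n / k n : ℝ)) := by
  have := fun n => (hindep n).isProbabilityMeasure
  have hq := two_le_card_field F
  set q := (Fintype.card F : ℝ)
  have hq1 : 0 < q - 1 := by linarith
  have hk1 := hk.eventually_ge_atTop 1
  have hscale : ∀ c : ℝ, ∀ n : ℕ, c * (1 / (Real.exp 1 * (q - 1)) * (k n * q ^ (n / k n : ℝ))) =
      c / (Real.exp 1 * (q - 1)) * k n * q ^ (n / k n : ℝ) := fun c n => by ring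
  refine isAasEquivalent_of_tails (fun n => by positivity) ?_ ?_ <;> simp only [hscale]
  · filter_upwards [Ioo_mem_nhdsGT one_pos] with ε hε
    exact tendsto_measure_circuitTime_lt hindep hunif hk1
      (tendsto_firstMoment_zero_of_lt_one hq (sub_nonneg.2 hε.2.le) (sub_lt_self 1 hε.1) hk)
  · filter_upwards [self_mem_nhdsWithin] with ε (hε : 0 < ε)
    exact tendsto_measure_lt_circuitTime hindep hunif hk1 (eventually_le_add_one_of_isLittleO hkn)
      one_half_lt_one
      (eventually_le_half_mul_floor (by linarith) (by positivity) hk1 hkn)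
      (tendsto_firstMoment_atTop_of_one_lt (by linarith) (lt_add_of_pos_right 1 hε) hk hkn)

end ShortCircuits

section CircuitRate

lemma circuitRate_self_neg {q a : ℝ} (hq : 2 ≤ q) (ha : a ≤ 1) : circuitRate q a a < 0 := by
  have hlog_nonneg : 0 ≤ Real.log (q - 1) := Real.log_nonneg (by linarith)
  have hlog_lt : Real.log (q - 1) < Real.log q := Real.log_lt_log (by linarith) (sub_one_lt q)
  simp only [circuitRate, sub_self, zero_mul]
  nlinarith

lemma continuous_circuitRate (q a : ℝ) : Continuous (circuitRate q a) := by
  have hshift : Continuous fun y : ℝ => (y - a) * Real.log (y - a) :=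
    Real.continuous_mul_log.comp (continuous_sub_right a)
  exact (((Real.continuous_mul_log.add_const _).sub continuous_const).sub hshift).sub
    continuous_const

lemma hasDerivAt_circuitRate (q : ℝ) {a y : ℝ} (hy : y ≠ 0) (hya : y - a ≠ 0) :
    HasDerivAt (circuitRate q a) (Real.log y - Real.log (y - a)) y := by
  have hderiv := ((((Real.hasDerivAt_mul_log hy).add_const (a * Real.log (q - 1))).sub_const
    (a * Real.log a)).sub ((Real.hasDerivAt_mul_log hya).comp_sub_const y a)).sub_const
    (Real.log q)
  rwa [add_sub_add_right_eq_sub] at hderiv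

lemma strictMonoOn_circuitRate (q : ℝ) {a : ℝ} (ha : 0 < a) :
    StrictMonoOn (circuitRate q a) (Set.Ici a) := by
  refine strictMonoOn_of_deriv_pos (convex_Ici a) (continuous_circuitRate q a).continuousOn ?_
  intro y hy
  rw [interior_Ici, Set.mem_Ioi] at hy
  rw [(hasDerivAt_circuitRate q (ha.trans hy).ne' (sub_pos.2 hy).ne').deriv, sub_pos]
  exact Real.log_lt_log (sub_pos.2 hy) (sub_lt_self y ha)

lemma exists_circuitRate_nonneg {q a : ℝ} (hq : 2 ≤ q) (ha : 0 < a) :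
    ∃ y, a < y ∧ 0 ≤ circuitRate q a y := by
  have hlogq : 0 < Real.log q := Real.log_pos (by linarith)
  set y := a * Real.exp (Real.log q / a) with hy
  have hay : a < y := lt_mul_of_one_lt_right ha (Real.one_lt_exp_iff.2 (by positivity))
  have hlogy : a * Real.log y = a * Real.log a + Real.log q := by
    rw [hy, Real.log_mul ha.ne' (Real.exp_ne_zero _), Real.log_exp, mul_add,
      mul_div_cancel₀ _ ha.ne']
  have hlog_nonneg : 0 ≤ Real.log (q - 1) := Real.log_nonneg (by linarith)
  have hlog_le : Real.log (y - a) ≤ Real.log y :=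
    Real.log_le_log (sub_pos.2 hay) (sub_le_self y ha.le)
  refine ⟨y, hay, ?_⟩
  unfold circuitRate
  nlinarith

lemma existsUnique_circuitRate_eq_zero {q a : ℝ} (hq : 2 ≤ q) (ha : 0 < a) (ha1 : a ≤ 1) :
    ∃! b, a ≤ b ∧ circuitRate q a b = 0 := by
  obtain ⟨y, hay, hy⟩ := exists_circuitRate_nonneg hq ha
  obtain ⟨b, hb, hb0⟩ := intermediate_value_Icc hay.le (continuous_circuitRate q a).continuousOn
    ⟨(circuitRate_self_neg hq ha1).le, hy⟩
  exact ⟨b, ⟨hb.1, hb0⟩, fun y hy =>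
    (strictMonoOn_circuitRate q ha).injOn hy.1 hb.1 (hy.2.trans hb0.symm)⟩

end CircuitRate

section LinearLength

lemma tendsto_natCast_atTop_of_tendsto_div {m : ℕ → ℕ} {c : ℝ} (hc : 0 < c)
    (hm : Tendsto (fun n => (m n / n : ℝ)) atTop (𝓝 c)) :
    Tendsto m atTop atTop := by
  rw [← tendsto_natCast_atTop_iff (R := ℝ)]
  refine (hm.pos_mul_atTop hc tendsto_natCast_atTop_atTop).congr' ?_
  filter_upwards [eventually_ne_atTop 0] with n hn
  exact div_mul_cancel₀ _ (Nat.cast_ne_zero.2 hn)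

lemma tendsto_log_factorial_div_sub {m : ℕ → ℕ} {c : ℝ} (hc : 0 < c)
    (hm : Tendsto (fun n => (m n / n : ℝ)) atTop (𝓝 c)) :
    Tendsto (fun n : ℕ => Real.log (m n).factorial / n - m n / n * Real.log n) atTop
      (𝓝 (c * Real.log c - c)) := by
  have hm_atTop := tendsto_natCast_atTop_of_tendsto_div hc hm
  have hinv : Tendsto (fun n : ℕ => (n : ℝ)⁻¹) atTop (𝓝 0) := tendsto_inv_atTop_nhds_zero_nat
  have hstirling : Tendsto (fun n => Real.log (Stirling.stirlingSeq (m n)) * (n : ℝ)⁻¹) atTop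
      (𝓝 0) := by
    simpa only [mul_zero, Function.comp_apply] using ((Stirling.tendsto_stirlingSeq_sqrt_pi.log
      (by positivity)).comp hm_atTop).mul hinv
  have hlog : Tendsto (fun n => Real.log (m n) / m n * (m n / n : ℝ)) atTop (𝓝 0) := by
    simpa only [zero_mul, Function.comp_apply, id] using
      (Real.isLittleO_log_id_atTop.tendsto_div_nhds_zero.comp
        (tendsto_natCast_atTop_atTop.comp hm_atTop)).mul hm
  have hlim := ((((Real.continuous_mul_log.tendsto c).comp hm).sub hm).add
    ((hlog.add (hinv.const_mul (Real.log 2))).const_mul (1 / 2))).add hstirling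
  simp only [mul_zero, add_zero] at hlim
  refine hlim.congr' ?_
  filter_upwards [hm_atTop.eventually_ne_atTop 0, eventually_ne_atTop 0] with n hmn hn
  have hmn' : (m n : ℝ) ≠ 0 := Nat.cast_ne_zero.2 hmn
  have hn' : (n : ℝ) ≠ 0 := Nat.cast_ne_zero.2 hn
  rw [Stirling.log_stirlingSeq_formula, Function.comp_apply, Real.log_div hmn' hn',
    Real.log_mul two_ne_zero hmn', Real.log_div hmn' (Real.exp_ne_zero _), Real.log_exp]
  field_simp
  ring

lemma tendsto_log_choose_div {m k : ℕ → ℕ} {y a : ℝ} (ha : 0 < a) (hay : a < y)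
    (hm : Tendsto (fun n => (m n / n : ℝ)) atTop (𝓝 y))
    (hk : Tendsto (fun n => (k n / n : ℝ)) atTop (𝓝 a)) :
    Tendsto (fun n : ℕ => Real.log ((m n).choose (k n)) / n) atTop
      (𝓝 (y * Real.log y - a * Real.log a - (y - a) * Real.log (y - a))) := by
  have hkm : ∀ᶠ n in atTop, k n ≤ m n := by
    filter_upwards [hk.eventually_lt hm hay, eventually_gt_atTop 0] with n hlt hn
    exact_mod_cast ((div_lt_div_iff_of_pos_right (Nat.cast_pos.2 hn)).1 hlt).le
  have hmk : Tendsto (fun n => ((m n - k n : ℕ) / n : ℝ)) atTop (𝓝 (y - a)) := by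
    refine (hm.sub hk).congr' ?_
    filter_upwards [hkm] with n hkm
    rw [Nat.cast_sub hkm, sub_div]
  have hlim := ((tendsto_log_factorial_div_sub (ha.trans hay) hm).sub
    (tendsto_log_factorial_div_sub ha hk)).sub (tendsto_log_factorial_div_sub (sub_pos.2 hay) hmk)
  convert hlim.congr' ?_ using 2
  · ring
  filter_upwards [hkm] with n hkm
  have hfactorial : ∀ j : ℕ, (j.factorial : ℝ) ≠ 0 := fun j => by positivity
  rw [Nat.cast_choose ℝ hkm,
    Real.log_div (hfactorial _) (mul_ne_zero (hfactorial _) (hfactorial _)),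
    Real.log_mul (hfactorial _) (hfactorial _), Nat.cast_sub hkm]
  ring

variable {q a y : ℝ} {m k : ℕ → ℕ}

lemma tendsto_log_firstMoment_div (hq : 1 < q) (ha : 0 < a) (hay : a < y)
    (hm : Tendsto (fun n => (m n / n : ℝ)) atTop (𝓝 y))
    (hk : Tendsto (fun n => (k n / n : ℝ)) atTop (𝓝 a)) :
    Tendsto (fun n => Real.log (firstMoment q n (m n) (k n)) / n) atTop
      (𝓝 (circuitRate q a y)) := by
  have hlim := ((tendsto_log_choose_div ha hay hm hk).add
    ((hk.sub tendsto_inv_atTop_nhds_zero_nat).mul_const (Real.log (q - 1)))).sub_const (Real.log q)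
  convert hlim.congr' ?_ using 2
  · rw [circuitRate]
    ring
  filter_upwards [hk.eventually_lt hm hay, eventually_gt_atTop 0,
    (tendsto_natCast_atTop_of_tendsto_div ha hk).eventually_ge_atTop 1] with n hlt hn hk1
  have hkm : k n ≤ m n := by
    exact_mod_cast ((div_lt_div_iff_of_pos_right (Nat.cast_pos.2 hn)).1 hlt).le
  have hchoose : ((m n).choose (k n) : ℝ) ≠ 0 := by exact_mod_cast (Nat.choose_pos hkm).ne'
  have : 0 < q - 1 := sub_pos.2 hq
  rw [firstMoment, Real.log_mul hchoose (by positivity), Real.log_div (by positivity)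
    (by positivity), Real.log_pow, Real.log_pow, Nat.cast_sub hk1, Nat.cast_one]
  field_simp
  ring

lemma eventually_exp_log_firstMoment (hq : 1 < q) (hay : a < y)
    (hm : Tendsto (fun n => (m n / n : ℝ)) atTop (𝓝 y))
    (hk : Tendsto (fun n => (k n / n : ℝ)) atTop (𝓝 a)) :
    (fun n : ℕ => Real.exp (n * (Real.log (firstMoment q n (m n) (k n)) / n))) =ᶠ[atTop]
      fun n => firstMoment q n (m n) (k n) := by
  filter_upwards [hk.eventually_lt hm hay, eventually_gt_atTop 0] with n hlt hn
  have hkm : k n ≤ m n := by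
    exact_mod_cast ((div_lt_div_iff_of_pos_right (Nat.cast_pos.2 hn)).1 hlt).le
  rw [mul_div_cancel₀ _ (Nat.cast_ne_zero.2 hn.ne'), Real.exp_log (firstMoment_pos hq n hkm)]

lemma tendsto_firstMoment_zero_of_circuitRate_neg (hq : 1 < q) (ha : 0 < a) (hay : a < y)
    (hneg : circuitRate q a y < 0) (hm : Tendsto (fun n => (m n / n : ℝ)) atTop (𝓝 y))
    (hk : Tendsto (fun n => (k n / n : ℝ)) atTop (𝓝 a)) :
    Tendsto (fun n => firstMoment q n (m n) (k n)) atTop (𝓝 0) :=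
  (Real.tendsto_exp_atBot.comp (tendsto_natCast_atTop_atTop.atTop_mul_neg hneg
    (tendsto_log_firstMoment_div hq ha hay hm hk))).congr'
    (eventually_exp_log_firstMoment hq hay hm hk)

lemma tendsto_firstMoment_atTop_of_circuitRate_pos (hq : 1 < q) (ha : 0 < a) (hay : a < y)
    (hpos : 0 < circuitRate q a y) (hm : Tendsto (fun n => (m n / n : ℝ)) atTop (𝓝 y))
    (hk : Tendsto (fun n => (k n / n : ℝ)) atTop (𝓝 a)) :
    Tendsto (fun n => firstMoment q n (m n) (k n)) atTop atTop :=
  (Real.tendsto_exp_atTop.comp (tendsto_natCast_atTop_atTop.atTop_mul_pos hpos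
    (tendsto_log_firstMoment_div hq ha hay hm hk))).congr'
    (eventually_exp_log_firstMoment hq hay hm hk)

lemma tendsto_floor_mul_natCast_div (hy : 0 ≤ y) :
    Tendsto (fun n : ℕ => (⌊y * n⌋₊ / n : ℝ)) atTop (𝓝 y) :=
  (tendsto_nat_floor_mul_div_atTop hy).comp tendsto_natCast_atTop_atTop

lemma exists_lt_one_eventually_le_mul (hy : 0 < y) (hay : a < y)
    (hm : Tendsto (fun n => (m n / n : ℝ)) atTop (𝓝 y))
    (hk : Tendsto (fun n => (k n / n : ℝ)) atTop (𝓝 a)) :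
    ∃ θ < (1 : ℝ), ∀ᶠ n in atTop, (k n : ℝ) ≤ θ * m n := by
  obtain ⟨θ, haθ, hθ⟩ := exists_between ((div_lt_one hy).2 hay)
  refine ⟨θ, hθ, ?_⟩
  filter_upwards [hk.eventually_lt (hm.const_mul θ) ((div_lt_iff₀ hy).1 haθ),
    eventually_gt_atTop 0] with n hlt hn
  rw [← mul_div_assoc] at hlt
  exact ((div_lt_div_iff_of_pos_right (Nat.cast_pos.2 hn)).1 hlt).le

lemma tendsto_div_natCast_of_isEquivalent {u : ℕ → ℝ} (hu : u ~[atTop] fun n => a * n) :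
    Tendsto (fun n => u n / n) atTop (𝓝 a) := by
  refine (hu.div IsEquivalent.refl |>.congr_right ?_).tendsto_const
  filter_upwards [eventually_ne_atTop 0] with n hn
  exact mul_div_cancel_right₀ a (Nat.cast_ne_zero.2 hn)

variable {F : Type*} [Field F] [Fintype F] [MeasurableSpace F] [MeasurableSingletonClass F]
  {Ω : ℕ → Type*} [∀ n, MeasurableSpace (Ω n)] {P : ∀ n, Measure (Ω n)}
  {v : ∀ n, ℕ → Ω n → (Fin n → F)} {b : ℝ}

lemma isAasEquivalent_circuitTime_of_tendsto_div (hindep : ∀ n, iIndepFun (v n) (P n))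
    (hunif : ∀ n i, HasLaw (v n i) (uniformOn Set.univ) (P n)) (ha : 0 < a) (hab : a < b)
    (hb : circuitRate (Fintype.card F) a b = 0)
    (hk : Tendsto (fun n => (k n / n : ℝ)) atTop (𝓝 a)) (hkn : ∀ᶠ n in atTop, k n ≤ n + 1) :
    IsAasEquivalent P (fun n ω => circuitTime (fun i => v n i ω) (k n)) fun n => b * n := by
  have := fun n => (hindep n).isProbabilityMeasure
  have hq := one_lt_two.trans_le (two_le_card_field F)
  have hmono := strictMonoOn_circuitRate (Fintype.card F) ha
  have hb0 : 0 < b := ha.trans hab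
  have hk1 := (tendsto_natCast_atTop_of_tendsto_div ha hk).eventually_ge_atTop 1
  refine isAasEquivalent_of_tails (fun n => by positivity) ?_ ?_ <;> simp only [← mul_assoc]
  · have hlow : Tendsto (fun ε : ℝ => (1 - ε) * b) (𝓝[>] 0) (𝓝 b) :=
      (Continuous.tendsto' (by fun_prop) _ _ (by ring)).mono_left nhdsWithin_le_nhds
    filter_upwards [hlow.eventually_const_lt hab, self_mem_nhdsWithin] with ε hay (hε : 0 < ε)
    have hyb : (1 - ε) * b < b := mul_lt_of_lt_one_left hb0 (sub_lt_self 1 hε)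
    have hrate := hb ▸ hmono hay.le hab.le hyb
    exact tendsto_measure_circuitTime_lt hindep hunif hk1
      (tendsto_firstMoment_zero_of_circuitRate_neg hq ha hay hrate
        (tendsto_floor_mul_natCast_div (ha.trans hay).le) hk)
  · filter_upwards [self_mem_nhdsWithin] with ε (hε : 0 < ε)
    have hby : b < (1 + ε) * b := lt_mul_of_one_lt_left hb0 (lt_add_of_pos_right 1 hε)
    have hay := hab.trans hby
    have hrate := hb ▸ hmono hab.le hay.le hby
    have hfloor := tendsto_floor_mul_natCast_div (hb0.trans hby).le
    obtain ⟨θ, hθ, hkθ⟩ := exists_lt_one_eventually_le_mul (hb0.trans hby) hay hfloor hk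
    exact tendsto_measure_lt_circuitTime hindep hunif hk1 hkn hθ hkθ
      (tendsto_firstMoment_atTop_of_circuitRate_pos hq ha hay hrate hfloor hk)

end LinearLength

theorem mainTheorem6 {F : Type*} [Field F] [Fintype F]
    [MeasurableSpace F] [MeasurableSingletonClass F]
    (q : ℕ) (hq : q = Fintype.card F)
    {Ω : ℕ → Type*} [∀ n, MeasurableSpace (Ω n)]
    (P : ∀ n, Measure (Ω n)) [∀ n, IsProbabilityMeasure (P n)]
    (v : ∀ n, ℕ → Ω n → (Fin n → F))
    (hmeas : ∀ n i, Measurable (v n i))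
    (hindep : ∀ n, iIndepFun (v n) (P n))
    (hunif : ∀ n i, HasLaw (v n i) (uniformOn Set.univ) (P n)) :
    -- (a) fixed length
    (∀ k : ℕ, 1 ≤ k →
      IsThetaInProbability P (fun n ω => circuitTime (fun i => v n i ω) k)
        (fun n => (q : ℝ) ^ ((n : ℝ) / (k : ℝ)))) ∧
    -- (b) growing sublinear length
    (∀ k : ℕ → ℕ, Tendsto k atTop atTop →
      (fun n => (k n : ℝ)) =o[atTop] (fun n => (n : ℝ)) →
      IsAasEquivalent P (fun n ω => circuitTime (fun i => v n i ω) (k n))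
        (fun n => 1 / (Real.exp 1 * ((q : ℝ) - 1)) *
          ((k n : ℝ) * (q : ℝ) ^ ((n : ℝ) / (k n : ℝ))))) ∧
    -- (c) linear length
    (∀ a : ℝ, 0 < a → a ≤ 1 →
      ∃ b : ℝ, (a ≤ b ∧ circuitRate q a b = 0 ∧
          ∀ y : ℝ, a ≤ y → circuitRate q a y = 0 → y = b) ∧
        ∀ k : ℕ → ℕ, (fun n => (k n : ℝ)) ~[atTop] (fun n => a * (n : ℝ)) →
          (∀ᶠ n in atTop, k n ≤ n + 1) →
          IsAasEquivalent P (fun n ω => circuitTime (fun i => v n i ω) (k n))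
            (fun n => b * (n : ℝ))) := by
  subst hq
  have hq := two_le_card_field F
  refine ⟨fun k hk => isThetaInProbability_circuitTime hindep hunif hk,
    fun k hk hkn => isAasEquivalent_circuitTime_of_isLittleO hindep hunif hk hkn,
    fun a ha ha1 => ?_⟩
  obtain ⟨b, ⟨hab, hb⟩, hunique⟩ := existsUnique_circuitRate_eq_zero hq ha ha1
  have hne : a ≠ b := fun h => (circuitRate_self_neg hq ha1).ne (h ▸ hb)
  exact ⟨b, ⟨hab, hb, fun y hy hy0 => hunique y ⟨hy, hy0⟩⟩, fun k hk hkn =>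
    isAasEquivalent_circuitTime_of_tendsto_div hindep hunif ha (hab.lt_of_ne hne) hb
      (tendsto_div_natCast_of_isEquivalent hk) hkn⟩
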